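/- Work on a word RAM whose words have $w=\Theta(\log n)$ bits ($w\ge c_0\lceil\log_2(n+1)\rceil$ for a suitable constant $c_0$), with unit-cost arithmetic, bitwise operations, comparisons and array accesses. Let $S[0..n-1]$ be a string whose characters are $w$-bit words. A mode of a non-empty multiset is an element whose multiplicity is no smaller than that of any other element. The range mode enumeration problem asks, for a query range $[l,r]$ with $0\le l\le r<n$, to output (each exactly once) all modes of the multiset $\{S[l],S[l+1],\dots,S[r]\}$; let $|\mathit{output}|$ be their number. Theorem. For every $\epsilon\in[0,1/2]$ and every such string $S$ there is a data structure (an index that depends on $S$ and $\epsilon$ but not on the query, and is stored in addition to the read-only string $S$) of $O(n^{2-2\epsilon}\log n)$ bits, working memory of the query algorithm included, with which every query $[l,r]$ of the range mode enumeration problem is answered in $O(n^{\epsilon}\,|\mathit{output}|)$ time. The query algorithm is one fixed program that does not depend on $n$, $S$ or $\epsilon$, and for $w\le c\lceil\log_2(n+1)\rceil$ the constants in the $O$-bounds depend only on $c$. The time bound holds for all $n\ge1$ and the space bound for all $n\ge2$. -/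

import Mathlib

namespace RangeMode

/-! ### Modes of a range of a string -/

/-- The multiset `{S[l], S[l+1], ..., S[r]}`. -/
def rangeMultiset {n : ℕ} (S : Fin n → ℕ) (l r : Fin n) : Multiset ℕ :=
  (Finset.Icc l r).val.map S

/-- `x` is a mode of `M`: an element whose multiplicity is no smaller than that of any other
element. -/
def IsMode (M : Multiset ℕ) (x : ℕ) : Prop :=
  x ∈ M ∧ ∀ y ∈ M, M.count y ≤ M.count x

/-! ### The word RAM -/

/-- Arithmetic and bitwise operations on words. -/
inductive BinOp where
  | add | sub | mul | div | mod | and | or | xor | shl | shr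

/-- The value of an operation on two `w`-bit words; it is reduced modulo `2 ^ w` when it is written
to a register (so `sub` is subtraction modulo `2 ^ w`). Division by `0` gives `0`. -/
def BinOp.eval (w : ℕ) : BinOp → ℕ → ℕ → ℕ
  | .add, a, b => a + b
  | .sub, a, b => a + 2 ^ w - b
  | .mul, a, b => a * b
  | .div, a, b => a / b
  | .mod, a, b => a % b
  | .and, a, b => a &&& b
  | .or, a, b => a ||| b
  | .xor, a, b => a ^^^ b
  | .shl, a, b => a <<< b
  | .shr, a, b => a >>> b

/-- The instructions of the word RAM. The arguments `d`, `a`, `b` are names of registers, `k` is a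
constant and `t` is the number of an instruction of the program. -/
inductive Instr where
  /-- put the constant `k` into register `d` -/
  | const (d k : ℕ)
  /-- apply `o` to registers `a` and `b`, result in register `d` -/
  | op (o : BinOp) (d a b : ℕ)
  /-- read the character of the input string at the position held by register `a` -/
  | readInput (d a : ℕ)
  /-- read the cell of the index at the address held by register `a` -/
  | readIndex (d a : ℕ)
  /-- read the cell of the work memory at the address held by register `a` -/
  | load (d a : ℕ)
  /-- write register `b` to the cell of the work memory at the address held by register `a` -/
  | store (a b : ℕ)
  /-- go to instruction `t` -/
  | jump (t : ℕ)
  /-- go to instruction `t` if register `a` and register `b` are equal -/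
  | jumpEq (a b t : ℕ)
  /-- go to instruction `t` if register `a` is smaller than register `b` -/
  | jumpLt (a b t : ℕ)
  /-- append register `a` to the output -/
  | emit (a : ℕ)
  /-- stop -/
  | halt

/-- A program is a finite list of instructions; in particular it names finitely many registers. -/
abbrev Program := List Instr

/-- A configuration of the machine: the program counter, the registers, the writable work memory,
and the output produced so far. -/
structure Config where
  pc : ℕ
  regs : ℕ → ℕ
  work : List ℕ
  out : List ℕ

/-- Write `v mod 2 ^ w` to register `d` and go to the next instruction. -/
def Config.setReg (w : ℕ) (c : Config) (d v : ℕ) : Config :=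
  { c with pc := c.pc + 1, regs := Function.update c.regs d (v % 2 ^ w) }

/-- Effect of an instruction of a machine with `w`-bit words, on the read-only input string `S` and
the read-only index `D`; `none` means that the machine stops. Reading outside the bounds of an array
gives `0`, and writing outside the bounds of the work memory has no effect. -/
def Instr.exec (w : ℕ) {n : ℕ} (S : Fin n → ℕ) (D : List ℕ) (c : Config) :
    Instr → Option Config
  | .const d k => some (c.setReg w d k)
  | .op o d a b => some (c.setReg w d (o.eval w (c.regs a) (c.regs b)))
  | .readInput d a =>
      some (c.setReg w d (if h : c.regs a < n then S ⟨c.regs a, h⟩ else 0))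
  | .readIndex d a => some (c.setReg w d (D.getD (c.regs a) 0))
  | .load d a => some (c.setReg w d (c.work.getD (c.regs a) 0))
  | .store a b => some { c with pc := c.pc + 1, work := c.work.set (c.regs a) (c.regs b) }
  | .jump t => some { c with pc := t }
  | .jumpEq a b t => some { c with pc := if c.regs a = c.regs b then t else c.pc + 1 }
  | .jumpLt a b t => some { c with pc := if c.regs a < c.regs b then t else c.pc + 1 }
  | .emit a => some { c with pc := c.pc + 1, out := c.out ++ [c.regs a] }
  | .halt => none

/-- One step of the program `P`. The machine also stops when the program counter leaves the
program. -/
def step (P : Program) (w : ℕ) {n : ℕ} (S : Fin n → ℕ) (D : List ℕ) (c : Config) :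
    Option Config :=
  P[c.pc]?.bind (Instr.exec w S D c)

/-- `HaltsIn P w S D c t out`: started in configuration `c`, the program `P` stops after exactly `t`
steps, and then the output is `out`. -/
inductive HaltsIn (P : Program) (w : ℕ) {n : ℕ} (S : Fin n → ℕ) (D : List ℕ) :
    Config → ℕ → List ℕ → Prop
  | halted {c : Config} (h : step P w S D c = none) : HaltsIn P w S D c 0 c.out
  | next {c c' : Config} {t : ℕ} {out : List ℕ} (h : step P w S D c = some c')
      (h' : HaltsIn P w S D c' t out) : HaltsIn P w S D c (t + 1) out

/-- The configuration in which the query `[l, r]` starts: registers `0` and `1` hold `l` and `r`,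
all other registers are `0`, and the work memory is as given. -/
def queryConfig (w l r : ℕ) (work : List ℕ) : Config where
  pc := 0
  regs := fun i => if i = 0 then l % 2 ^ w else if i = 1 then r % 2 ^ w else 0
  work := work
  out := []

/-- On the string `S` with index `D` (an array of `w`-bit words) and `m` cells of work memory, the
program `P` solves the query `[l, r]` of the range mode enumeration problem within time
`T |output|`, whatever the work memory contains at the beginning: it stops after having output every
mode of `S[l], ..., S[r]` exactly once. -/
def SolvesQuery (P : Program) (w : ℕ) {n : ℕ} (S : Fin n → ℕ) (D : List ℕ) (m : ℕ) (T : ℝ)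
    (l r : Fin n) : Prop :=
  ∀ work : List ℕ, work.length = m → (∀ v ∈ work, v < 2 ^ w) →
    ∃ (t : ℕ) (out : List ℕ), HaltsIn P w S D (queryConfig w l r work) t out ∧
      out.Nodup ∧ (∀ x, x ∈ out ↔ IsMode (rangeMultiset S l r) x) ∧
      (t : ℝ) ≤ T * out.length

end RangeMode

/-! Cut the string into blocks of length b = ⌈n^ε⌉. A query then consists of a run [u, v) of full
blocks and fewer than 2b positions outside it. For each run the index stores the largest frequency
and the last position at which a mode of the run is completed. That is O((n/b)²) words. The rank of
each position in the order by character and then by position, together with the inverse map, takes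
O(n) more words, and n ≤ n^(2-2ε) because ε ≤ 1/2. Occurrences of one character have consecutive
ranks, so "more than f occurrences from i up to r" is a single lookup: move f ranks forward, then
compare the character and the position (`posOfRank_add_lt_iff`; backwards `le_posOfRank_sub_iff`).

The largest frequency F of the query is found by starting from the stored value of the run and
raising f while some outside position witnesses more than f occurrences. This suffices
(`maxFreq_le_of_outside`) and raises f fewer than 2b times (`maxFreq_le_add`). A mode that occurs
outside the run is output at its first occurrence if that is outside, and otherwise at its last one;
this makes the output duplicate-free and complete (`IsReported.inj`, `exists_isReported_iff`).

The remaining modes are exactly the characters with F occurrences in [u, v) (`lt_freq_part_iff`).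
They are output at their last occurrences: jump to the stored last position, walk left to a block
boundary i, then look up the run [u, i), and stop once its largest frequency is below F. Each jump
lands on a new mode, which pays for the at most b steps of the walk (`blockGoal`,
`exists_ends_blocks`). Since there is at least one mode, the O(b) cost of the two scans is also O(b
|output|) (`exists_ends_query`).

The statements about the program run backwards: a bound for the rest of the execution gives a bound
that is larger by the cost of the part in front. -/

namespace RangeMode

/-! ### Symbolic execution -/

/-- The character at a position of `S`, and `0` behind the end of `S`. -/
def charAt {n : ℕ} (S : Fin n → ℕ) (i : ℕ) : ℕ := if h : i < n then S ⟨i, h⟩ else 0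

/-- Started in configuration `c`, the program stops within `T` steps with output `o`. -/
def Ends (P : Program) (w : ℕ) {n : ℕ} (S : Fin n → ℕ) (D : List ℕ) (c : Config) (T : ℕ)
    (o : List ℕ) : Prop :=
  ∃ t ≤ T, HaltsIn P w S D c t o

/-- The configuration whose registers are given by a list (and are `0` behind its end). -/
def st (pc : ℕ) (L work out : List ℕ) : Config := ⟨pc, fun i => L.getD i 0, work, out⟩

section
variable {P : Program} {w n : ℕ} {S : Fin n → ℕ} {D L work out o : List ℕ} {pc T d a b k t v : ℕ}

theorem Ends.mono {c : Config} {T' : ℕ} (h : Ends P w S D c T o) (hT : T ≤ T') :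
    Ends P w S D c T' o := by
  obtain ⟨t, ht, h⟩ := h
  exact ⟨t, ht.trans hT, h⟩

theorem Ends.of_step {c c' : Config} (hs : step P w S D c = some c') (h : Ends P w S D c' T o) :
    Ends P w S D c (T + 1) o := by
  obtain ⟨t, ht, h⟩ := h
  exact ⟨t + 1, by omega, .next hs h⟩

/-- The side condition is a Boolean equation so that `rfl` settles it for explicit register lists.
-/
theorem setReg_st (hd : Nat.blt d L.length = true) :
    (st pc L work out).setReg w d v = st (pc + 1) (L.set d (v % 2 ^ w)) work out := by
  have hd : d < L.length := by simpa using hd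
  simp only [Config.setReg, st, Config.mk.injEq, and_true, true_and]
  funext i
  by_cases h : i = d
  · subst h; simp [hd]
  · simp [h, List.getD_eq_getElem?_getD, Ne.symm h]

theorem ends_set {v' : ℕ} {I : Instr} (hP : P[pc]? = some I) (hd : Nat.blt d L.length = true)
    (hI : I.exec w S D (st pc L work out) = some ((st pc L work out).setReg w d v'))
    (hv : v' % 2 ^ w = v) (h : Ends P w S D (st (pc + 1) (L.set d v) work out) T o) :
    Ends P w S D (st pc L work out) (T + 1) o := by
  refine Ends.of_step (c' := st (pc + 1) (L.set d v) work out) ?_ h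
  have : (st pc L work out).pc = pc := rfl
  rw [step, this, hP, Option.bind_some, hI, setReg_st hd, hv]

theorem ends_const (hP : P[pc]? = some (.const d k)) (hd : Nat.blt d L.length = true)
    (hk : k < 2 ^ w) (h : Ends P w S D (st (pc + 1) (L.set d k) work out) T o) :
    Ends P w S D (st pc L work out) (T + 1) o :=
  ends_set hP hd rfl (Nat.mod_eq_of_lt hk) h

theorem ends_add (hP : P[pc]? = some (.op .add d a b)) (hd : Nat.blt d L.length = true)
    (hk : L.getD a 0 + L.getD b 0 < 2 ^ w)
    (h : Ends P w S D (st (pc + 1) (L.set d (L.getD a 0 + L.getD b 0)) work out) T o) :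
    Ends P w S D (st pc L work out) (T + 1) o :=
  ends_set hP hd rfl (Nat.mod_eq_of_lt hk) h

theorem ends_mul (hP : P[pc]? = some (.op .mul d a b)) (hd : Nat.blt d L.length = true)
    (hk : L.getD a 0 * L.getD b 0 < 2 ^ w)
    (h : Ends P w S D (st (pc + 1) (L.set d (L.getD a 0 * L.getD b 0)) work out) T o) :
    Ends P w S D (st pc L work out) (T + 1) o :=
  ends_set hP hd rfl (Nat.mod_eq_of_lt hk) h

theorem ends_sub (hP : P[pc]? = some (.op .sub d a b)) (hd : Nat.blt d L.length = true)
    (hb : L.getD b 0 ≤ L.getD a 0) (hk : L.getD a 0 < 2 ^ w)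
    (h : Ends P w S D (st (pc + 1) (L.set d (L.getD a 0 - L.getD b 0)) work out) T o) :
    Ends P w S D (st pc L work out) (T + 1) o := by
  refine ends_set hP hd rfl ?_ h
  change (L.getD a 0 + 2 ^ w - L.getD b 0) % 2 ^ w = _
  rw [Nat.sub_add_comm hb, Nat.add_mod_right, Nat.mod_eq_of_lt (by omega)]

theorem ends_div (hP : P[pc]? = some (.op .div d a b)) (hd : Nat.blt d L.length = true)
    (hk : L.getD a 0 < 2 ^ w)
    (h : Ends P w S D (st (pc + 1) (L.set d (L.getD a 0 / L.getD b 0)) work out) T o) :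
    Ends P w S D (st pc L work out) (T + 1) o :=
  ends_set hP hd rfl (Nat.mod_eq_of_lt ((Nat.div_le_self _ _).trans_lt hk)) h

theorem ends_mod (hP : P[pc]? = some (.op .mod d a b)) (hd : Nat.blt d L.length = true)
    (hk : L.getD a 0 < 2 ^ w)
    (h : Ends P w S D (st (pc + 1) (L.set d (L.getD a 0 % L.getD b 0)) work out) T o) :
    Ends P w S D (st pc L work out) (T + 1) o :=
  ends_set hP hd rfl (Nat.mod_eq_of_lt ((Nat.mod_le _ _).trans_lt hk)) h

theorem ends_readIndex (hP : P[pc]? = some (.readIndex d a)) (hd : Nat.blt d L.length = true)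
    (hk : D.getD (L.getD a 0) 0 % 2 ^ w = v)
    (h : Ends P w S D (st (pc + 1) (L.set d v) work out) T o) :
    Ends P w S D (st pc L work out) (T + 1) o :=
  ends_set hP hd rfl hk h

theorem ends_readInput (hS : ∀ i, S i < 2 ^ w) (hP : P[pc]? = some (.readInput d a))
    (hd : Nat.blt d L.length = true)
    (h : Ends P w S D (st (pc + 1) (L.set d (charAt S (L.getD a 0))) work out) T o) :
    Ends P w S D (st pc L work out) (T + 1) o := by
  refine ends_set hP hd rfl ?_ h
  change charAt S (L.getD a 0) % 2 ^ w = _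
  refine Nat.mod_eq_of_lt ?_
  unfold charAt
  split
  · exact hS _
  · positivity

theorem ends_jump (hP : P[pc]? = some (.jump t)) (h : Ends P w S D (st t L work out) T o) :
    Ends P w S D (st pc L work out) (T + 1) o :=
  Ends.of_step (by simp [step, st, hP, Instr.exec]) h

theorem ends_jumpEq (hP : P[pc]? = some (.jumpEq a b t))
    (h₁ : L.getD a 0 = L.getD b 0 → Ends P w S D (st t L work out) T o)
    (h₂ : L.getD a 0 ≠ L.getD b 0 → Ends P w S D (st (pc + 1) L work out) T o) :
    Ends P w S D (st pc L work out) (T + 1) o := by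
  by_cases hab : L.getD a 0 = L.getD b 0
  · exact Ends.of_step (by simp only [step, st, hP, Instr.exec, Option.bind_some, hab, if_true])
      (h₁ hab)
  · exact Ends.of_step (by simp only [step, st, hP, Instr.exec, Option.bind_some, hab, if_false])
      (h₂ hab)

theorem ends_jumpLt (hP : P[pc]? = some (.jumpLt a b t))
    (h₁ : L.getD a 0 < L.getD b 0 → Ends P w S D (st t L work out) T o)
    (h₂ : L.getD b 0 ≤ L.getD a 0 → Ends P w S D (st (pc + 1) L work out) T o) :
    Ends P w S D (st pc L work out) (T + 1) o := by
  by_cases hab : L.getD a 0 < L.getD b 0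
  · exact Ends.of_step (by simp only [step, st, hP, Instr.exec, Option.bind_some, hab, if_true])
      (h₁ hab)
  · exact Ends.of_step (by simp only [step, st, hP, Instr.exec, Option.bind_some, hab, if_false])
      (h₂ (not_lt.1 hab))

theorem ends_emit (hP : P[pc]? = some (.emit a))
    (h : Ends P w S D (st (pc + 1) L work (out ++ [L.getD a 0])) T o) :
    Ends P w S D (st pc L work out) (T + 1) o :=
  Ends.of_step (by simp [step, st, hP, Instr.exec]) h

theorem ends_halt (hP : P[pc]? = some .halt) : Ends P w S D (st pc L work out) T out :=
  ⟨0, T.zero_le, .halted (c := st pc L work out) (by simp [step, st, hP, Instr.exec])⟩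

end

/-! ### The query program -/

/-- The query program. Registers: `0`, `1` the query `l`, `r`; `2`, `3` the constants `1`, `5`;
`4` the block size `b`; `5` five times the row length of the tables; `6`, `7` the ends `u`, `v` of the
part of the query that consists of full blocks; `8` five times the current frequency `f`; `9` the
current position; `10`, `11`, `12`, `15` scratch; `13` the address of a table row; `14` five times the
frequency of the modes of the current run of blocks; `16` five times `f - 1`; `17` the constant `0`;
`18` the address of a table entry. -/
def queryProgram : Program :=
  [.const 2 1, .const 3 5, .readIndex 4 17, .readIndex 5 3, .op .add 6 0 4,
   .op .sub 6 6 2, .op .div 6 6 4, .op .mul 13 6 5, .const 10 3, .op .add 13 13 10,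
   .op .mul 6 6 4, .op .add 7 1 2, .op .div 7 7 4, .op .mul 10 7 3, .op .add 10 10 13,
   .op .add 18 10 2, .readIndex 8 10, .op .add 14 8 17, .op .mul 7 7 4, .op .add 9 0 17,
   -- 20: find the largest frequency
   .jumpEq 9 6 22, .jump 23, .op .add 9 7 17, .jumpLt 1 9 44,
   .op .mul 10 9 3, .op .add 10 10 2, .readIndex 10 10, .readInput 15 9,
   .op .add 11 10 8, .readIndex 12 11, .jumpLt 12 0 34, .jumpLt 1 12 34, .readInput 11 12,
   .jumpEq 11 15 42,
   .op .sub 11 10 8, .readIndex 12 11, .jumpLt 12 0 40, .jumpLt 1 12 40, .readInput 11 12,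
   .jumpEq 11 15 42,
   .op .add 9 9 2, .jump 20, .op .add 8 8 3, .jump 20,
   -- 44: output the modes that occur outside of the full blocks
   .op .sub 16 8 3, .op .add 9 0 17,
   .jumpEq 9 6 48, .jump 49, .op .add 9 7 17, .jumpLt 1 9 71,
   .op .mul 10 9 3, .op .add 10 10 2, .readIndex 10 10, .readInput 15 9,
   .op .add 11 10 16, .readIndex 12 11, .jumpLt 12 0 60, .jumpLt 1 12 60, .readInput 11 12,
   .jumpEq 11 15 69,
   .op .sub 11 10 16, .readIndex 12 11, .jumpLt 12 6 67, .jumpLt 12 7 65, .jump 67,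
   .readInput 11 12, .jumpEq 11 15 69,
   .op .add 9 9 2, .jump 46, .emit 15, .jump 67,
   -- 71: output the modes of the full blocks, if their frequency is the largest one
   .jumpEq 8 14 73, .halt, .readIndex 9 18,
   .op .mul 10 9 3, .op .add 10 10 2, .readIndex 10 10, .readInput 15 9,
   .op .sub 11 10 16, .readIndex 12 11, .jumpLt 12 6 84, .jumpLt 9 12 84, .readInput 11 12,
   .jumpEq 11 15 88,
   .op .mod 10 9 4, .jumpEq 10 17 90, .op .sub 9 9 2, .jump 74, .emit 15, .jump 84,
   .op .div 10 9 4, .op .mul 10 10 3, .op .add 10 10 13, .op .add 18 10 2, .readIndex 14 10,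
   .jump 71]

/-! ### Counting occurrences -/

/-- The number of occurrences of `x` before position `a`. -/
def occ (s : ℕ → ℕ) (x a : ℕ) : ℕ := Nat.count (fun j => s j = x) a

/-- The number of occurrences of `x` at the positions `j` with `a ≤ j < b`. -/
def freq (s : ℕ → ℕ) (x a b : ℕ) : ℕ := occ s x b - occ s x a

/-- The largest frequency of a character at the positions `j` with `a ≤ j < b`. -/
def maxFreq (s : ℕ → ℕ) (n a b : ℕ) : ℕ := (Finset.range n).sup fun i => freq s (s i) a b

/-- The position of `i` in the list of all positions, sorted by character and then by position;
the numbering starts with `n`. -/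
def rank (s : ℕ → ℕ) (n i : ℕ) : ℕ :=
  n + ((Finset.range n).filter fun j => s j < s i).card + occ s (s i) i

open Classical in
/-- The position of rank `k`, or `n` if there is none. -/
noncomputable def posOfRank (s : ℕ → ℕ) (n k : ℕ) : ℕ :=
  if h : ∃ i, i < n ∧ rank s n i = k then h.choose else n

/-- The greatest position before `v` at which a character of largest frequency between `u` and `v`
occurs for the last time. -/
def lastMode (s : ℕ → ℕ) (n u v : ℕ) : ℕ :=
  Nat.findGreatest (fun j => maxFreq s n u v ≤ freq s (s j) u (j + 1)) (v - 1)

section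
variable {s : ℕ → ℕ} {n a b i j k x : ℕ}

theorem occ_mono (s : ℕ → ℕ) (x : ℕ) (h : a ≤ b) : occ s x a ≤ occ s x b := Nat.count_monotone _ h

theorem occ_succ (s : ℕ → ℕ) (x a : ℕ) : occ s x (a + 1) = occ s x a + if s a = x then 1 else 0 :=
  Nat.count_succ _ _

theorem occ_succ_self (s : ℕ → ℕ) (a : ℕ) : occ s (s a) (a + 1) = occ s (s a) a + 1 := by
  simp [occ_succ]

theorem occ_sub_le (s : ℕ → ℕ) (x : ℕ) (h : a ≤ b) : occ s x b ≤ occ s x a + (b - a) := by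
  induction b, h using Nat.le_induction with
  | base => simp
  | succ b h ih => rw [occ_succ]; split <;> omega

/-- A discrete intermediate value argument: `occ` grows by at most one per position, and only at
occurrences of `x`. This is the source of the first, last and `k`-th occurrences used below. -/
theorem exists_occ (h : occ s x a ≤ k) (h' : k < occ s x b) :
    ∃ j, a ≤ j ∧ j < b ∧ s j = x ∧ occ s x j = k := by
  induction b with
  | zero => simp [occ] at h'
  | succ b ih =>
    by_cases hb : k < occ s x b
    · obtain ⟨j, h1, h2, h3⟩ := ih hb
      exact ⟨j, h1, by omega, h3⟩
    · have := occ_succ s x b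
      have h3 : s b = x := by
        by_contra hne
        rw [if_neg hne] at this
        omega
      rw [if_pos h3] at this
      refine ⟨b, ?_, by omega, h3, by omega⟩
      by_contra hab
      have := occ_mono s x (show b + 1 ≤ a by omega)
      omega

theorem occ_card (s : ℕ → ℕ) (x a : ℕ) :
    occ s x a = ((Finset.range a).filter fun j => s j = x).card :=
  Nat.count_eq_card_filter_range _ _

/-- Hence the rank intervals of different characters do not overlap. -/
theorem card_lt_add_occ_le (s : ℕ → ℕ) (n : ℕ) {x y : ℕ} (h : x < y) :
    ((Finset.range n).filter fun j => s j < x).card + occ s x n ≤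
      ((Finset.range n).filter fun j => s j < y).card := by
  rw [occ_card, ← Finset.card_union_of_disjoint]
  · refine Finset.card_le_card fun j hj => ?_
    simp only [Finset.mem_union, Finset.mem_filter] at hj ⊢
    rcases hj with hj | hj
    · exact ⟨hj.1, by omega⟩
    · exact ⟨hj.1, by omega⟩
  · refine Finset.disjoint_filter.2 fun j _ h1 h2 => ?_
    omega

theorem le_rank (s : ℕ → ℕ) (n i : ℕ) : n ≤ rank s n i := by unfold rank; omega

theorem occ_lt_occ (hij : i < j) : occ s (s i) i < occ s (s i) j := by
  have := occ_succ_self s i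
  have := occ_mono s (s i) (show i + 1 ≤ j from hij)
  omega

theorem rank_lt (hi : i < n) : rank s n i < 2 * n := by
  -- With the successor of `s i` as the larger character, the right-hand side is at most `n`.
  have h1 := card_lt_add_occ_le s n (Nat.lt_succ_self (s i))
  have h2 := Finset.card_filter_le (Finset.range n) fun j => s j < (s i).succ
  rw [Finset.card_range] at h2
  have := occ_lt_occ (s := s) hi
  unfold rank
  omega

theorem rank_lt_of_lt (hi : i < n) (h : s i < s j) : rank s n i < rank s n j := by
  have h1 := card_lt_add_occ_le s n h
  have := occ_lt_occ (s := s) hi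
  unfold rank
  omega

theorem rank_inj (hi : i < n) (hj : j < n) (h : rank s n i = rank s n j) : i = j := by
  rcases lt_trichotomy (s i) (s j) with h1 | h1 | h1
  · have := rank_lt_of_lt hi h1; omega
  · rcases lt_trichotomy i j with h2 | h2 | h2
    · have := occ_lt_occ (s := s) h2
      unfold rank at h; rw [h1] at h this; omega
    · exact h2
    · have := occ_lt_occ (s := s) h2
      unfold rank at h; rw [h1] at h; omega
  · have := rank_lt_of_lt hj h1; omega

/-- For a fixed character, `rank` and `occ` differ by a constant. -/
theorem rank_eq_add_iff (h : s j = s i) :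
    rank s n j = rank s n i + k ↔ occ s (s i) j = occ s (s i) i + k := by
  unfold rank; rw [h]; omega

theorem posOfRank_rank (hi : i < n) : posOfRank s n (rank s n i) = i := by
  have h : ∃ j, j < n ∧ rank s n j = rank s n i := ⟨i, hi, rfl⟩
  rw [posOfRank, dif_pos h]
  exact rank_inj h.choose_spec.1 hi h.choose_spec.2

theorem rank_posOfRank (h : posOfRank s n k < n) : rank s n (posOfRank s n k) = k := by
  by_cases hk : ∃ i, i < n ∧ rank s n i = k
  · rw [posOfRank, dif_pos hk]
    exact hk.choose_spec.2
  · rw [posOfRank, dif_neg hk] at h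
    omega

theorem posOfRank_le (s : ℕ → ℕ) (n k : ℕ) : posOfRank s n k ≤ n := by
  unfold posOfRank
  split_ifs with h
  · exact h.choose_spec.1.le
  · rfl

theorem le_posOfRank_add (h : posOfRank s n (rank s n i + k) < n)
    (hs : s (posOfRank s n (rank s n i + k)) = s i) : i ≤ posOfRank s n (rank s n i + k) := by
  have h1 := (rank_eq_add_iff hs).1 (rank_posOfRank h)
  by_contra hlt
  have h2 := occ_lt_occ (s := s) (not_le.1 hlt)
  rw [hs] at h2
  omega

/-- The forward test in constant time: the position `k` ranks further on carries the same character
exactly if it is the `k`-th occurrence after `i`. -/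
theorem posOfRank_add_lt_iff (hb : b ≤ n) :
    (posOfRank s n (rank s n i + k) < b ∧ s (posOfRank s n (rank s n i + k)) = s i) ↔
      k < freq s (s i) i b := by
  constructor
  · rintro ⟨h, hs⟩
    have h1 := (rank_eq_add_iff hs).1 (rank_posOfRank (h.trans_le hb))
    have h2 := occ_lt_occ (s := s) h
    rw [hs] at h2
    unfold freq
    omega
  · intro h
    unfold freq at h
    obtain ⟨j, h1, h2, h3, h4⟩ := exists_occ (s := s) (x := s i) (a := i) (b := b)
      (k := occ s (s i) i + k) (by omega) (by omega)
    rw [← (rank_eq_add_iff h3).2 h4, posOfRank_rank (h2.trans_le hb)]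
    exact ⟨h2, h3⟩

theorem posOfRank_sub_le (hk : k ≤ n) (h : posOfRank s n (rank s n i - k) < n)
    (hs : s (posOfRank s n (rank s n i - k)) = s i) : posOfRank s n (rank s n i - k) ≤ i := by
  have h0 := rank_posOfRank h
  have h1 := le_rank s n i
  -- The subtraction does not truncate: ranks start at `n`, and `k ≤ n`.
  have h2 : rank s n i = rank s n (posOfRank s n (rank s n i - k)) + k := by omega
  have h3 := (rank_eq_add_iff hs.symm).1 h2
  by_contra hlt
  have h4 := occ_lt_occ (s := s) (not_le.1 hlt)
  rw [hs] at h3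
  omega

/-- The backward test. Unlike in the forward one, the bound `< n` must be asked for, since the
default value `n` of `posOfRank` would pass `a ≤ _`. -/
theorem le_posOfRank_sub_iff (hi : i < n) (hk : k ≤ n) :
    (a ≤ posOfRank s n (rank s n i - k) ∧ posOfRank s n (rank s n i - k) < n ∧
      s (posOfRank s n (rank s n i - k)) = s i) ↔ k < freq s (s i) a (i + 1) := by
  have h1 := le_rank s n i
  have h5 := occ_succ_self s i
  constructor
  · rintro ⟨ha, h, hs⟩
    have h0 := rank_posOfRank h
    have h2 : rank s n i = rank s n (posOfRank s n (rank s n i - k)) + k := by omega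
    have h3 := (rank_eq_add_iff hs.symm).1 h2
    rw [hs] at h3
    have h4 := occ_mono s (s i) ha
    unfold freq
    omega
  · intro h
    unfold freq at h
    obtain ⟨j, h2, h3, h4, h6⟩ := exists_occ (s := s) (x := s i) (a := a) (b := i + 1)
      (k := occ s (s i) i - k) (by omega) (by omega)
    have h7 : rank s n i = rank s n j + k := by
      rw [rank_eq_add_iff h4.symm, h4]
      omega
    have hj : j < n := by omega
    rw [h7, Nat.add_sub_cancel, posOfRank_rank hj]
    exact ⟨h2, hj, h4⟩

theorem exists_of_freq_pos (h : 0 < freq s x a b) : ∃ j, a ≤ j ∧ j < b ∧ s j = x := by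
  unfold freq at h
  obtain ⟨j, h1, h2, h3, -⟩ := exists_occ (s := s) (x := x) (a := a) (b := b)
    (k := occ s x a) le_rfl (by omega)
  exact ⟨j, h1, h2, h3⟩

/-- The supremum runs only over characters of the string, but a character of positive frequency
before `b ≤ n` is one of them. -/
theorem freq_le_maxFreq (hb : b ≤ n) (s : ℕ → ℕ) (x a : ℕ) : freq s x a b ≤ maxFreq s n a b := by
  rcases Nat.eq_zero_or_pos (freq s x a b) with h | h
  · omega
  · obtain ⟨j, -, h2, rfl⟩ := exists_of_freq_pos h
    exact Finset.le_sup (f := fun i => freq s (s i) a b) (Finset.mem_range.2 (h2.trans_le hb))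

theorem exists_freq_eq_maxFreq (s : ℕ → ℕ) (hn : 0 < n) (a b : ℕ) :
    ∃ x, freq s x a b = maxFreq s n a b := by
  obtain ⟨i, -, h⟩ := Finset.exists_mem_eq_sup (Finset.range n) ⟨0, Finset.mem_range.2 hn⟩
    fun i => freq s (s i) a b
  exact ⟨s i, h.symm⟩

theorem maxFreq_le (s : ℕ → ℕ) (n a b : ℕ) : maxFreq s n a b ≤ b := by
  refine Finset.sup_le fun i _ => ?_
  have := occ_sub_le s (s i) b.zero_le
  have h0 : occ s (s i) 0 = 0 := by simp [occ]
  unfold freq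
  omega

theorem lastMode_spec {u v : ℕ} (hn : 0 < n) (h : 0 < maxFreq s n u v) :
    lastMode s n u v < v ∧
      maxFreq s n u v ≤ freq s (s (lastMode s n u v)) u (lastMode s n u v + 1) ∧
      ∀ j, lastMode s n u v < j → j < v → freq s (s j) u (j + 1) < maxFreq s n u v := by
  obtain ⟨x, hx⟩ := exists_freq_eq_maxFreq s hn u v
  -- The last occurrence of a most frequent character satisfies the predicate, so the search does
  -- not return its default.
  obtain ⟨j, h1, h2, rfl, h3⟩ := exists_occ (s := s) (x := x) (a := u) (b := v)
    (k := occ s x v - 1) (by unfold freq at hx; omega) (by unfold freq at hx; omega)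
  have hj : maxFreq s n u v ≤ freq s (s j) u (j + 1) := by
    have := occ_succ_self s j
    unfold freq at hx ⊢
    omega
  have h4 := Nat.findGreatest_spec
    (P := fun j => maxFreq s n u v ≤ freq s (s j) u (j + 1)) (show j ≤ v - 1 by omega) hj
  have h5 := Nat.findGreatest_le (P := fun j => maxFreq s n u v ≤ freq s (s j) u (j + 1)) (v - 1)
  refine ⟨?_, h4, fun k hk hkv => ?_⟩
  · unfold lastMode; omega
  · exact not_le.1 (Nat.findGreatest_is_greatest
      (P := fun j => maxFreq s n u v ≤ freq s (s j) u (j + 1)) hk (by omega))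

theorem lastMode_le (s : ℕ → ℕ) (n u v : ℕ) : lastMode s n u v ≤ v :=
  (Nat.findGreatest_le _).trans (Nat.sub_le _ _)

end

theorem count_rangeMultiset {n : ℕ} (S : Fin n → ℕ) {l r : Fin n} (h : l ≤ r) (x : ℕ) :
    (rangeMultiset S l r).count x = freq (charAt S) x l (r + 1) := by
  have h1 : occ (charAt S) x (r + 1) = occ (charAt S) x l +
      ((Finset.Ico (l : ℕ) (r + 1)).filter fun j => charAt S j = x).card := by
    have hlr : (l : ℕ) ≤ r + 1 := by have : (l : ℕ) ≤ r := h; omega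
    rw [occ_card, occ_card, ← Finset.card_union_of_disjoint, ← Finset.filter_union]
    · congr 2
      ext j; simp; omega
    · refine Finset.disjoint_filter_filter ?_
      rw [Finset.disjoint_left]
      intro j; simp; omega
  rw [freq, h1, Nat.add_sub_cancel_left, rangeMultiset, Multiset.count_map, ← Finset.filter_val,
    Finset.card_val]
  rw [← Finset.card_map Fin.valEmbedding]
  congr 1
  ext j
  simp only [Finset.mem_map, Finset.mem_filter, Finset.mem_Icc, Fin.valEmbedding_apply,
    Finset.mem_Ico]
  constructor
  · rintro ⟨a, ⟨⟨h2, h3⟩, rfl⟩, rfl⟩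
    exact ⟨⟨h2, Nat.lt_succ_iff.2 h3⟩, by simp [charAt]⟩
  · rintro ⟨⟨h1, h2⟩, h3⟩
    have hj : j < n := by omega
    refine ⟨⟨j, hj⟩, ⟨⟨h1, Nat.lt_succ_iff.1 h2⟩, ?_⟩, rfl⟩
    rw [← h3, charAt, dif_pos hj]

theorem isMode_rangeMultiset_iff {n : ℕ} (S : Fin n → ℕ) {l r : Fin n} (h : l ≤ r) (x : ℕ) :
    IsMode (rangeMultiset S l r) x ↔
      freq (charAt S) x l (r + 1) = maxFreq (charAt S) n l (r + 1) := by
  have hr : (r : ℕ) + 1 ≤ n := r.2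
  unfold IsMode
  simp only [count_rangeMultiset S h, ← Multiset.one_le_count_iff_mem]
  constructor
  · rintro ⟨h1, h2⟩
    refine le_antisymm (freq_le_maxFreq hr _ _ _) ?_
    obtain ⟨y, hy⟩ := exists_freq_eq_maxFreq (charAt S) (by omega : 0 < n) l (r + 1)
    rw [← hy]
    by_cases hy1 : 1 ≤ freq (charAt S) y l (r + 1)
    · exact h2 y hy1
    · omega
  · intro h1
    refine ⟨?_, fun y _ => h1 ▸ freq_le_maxFreq hr _ _ _⟩
    have h2 := freq_le_maxFreq hr (charAt S) (charAt S l) l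
    have h3 := occ_succ_self (charAt S) l
    have h4 : (l : ℕ) ≤ r := h
    have h5 := occ_mono (charAt S) (charAt S l) (show (l : ℕ) + 1 ≤ r + 1 by omega)
    rw [h1]
    unfold freq at h2
    omega

/-! ### Modes inside and outside of the full blocks -/

/-- `[u, v)` is a part of the range `[l, r]`, or the whole range lies before `u` and after `v`. -/
structure IsPart (n l r u v : ℕ) : Prop where
  lt : r < n
  left : l ≤ u
  right : v ≤ r + 1
  order : u ≤ v ∨ v < l ∧ r + 1 < u

/-- Position `j` lies in `[l, r]`, but not in the part `[u, v)`. -/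
def IsOutside (l r u v j : ℕ) : Prop := l ≤ j ∧ j ≤ r ∧ (j < u ∨ v ≤ j)

/-- The condition under which the character at a position outside of `[u, v)` is output: more than
`k` occurrences up to `r` start there, or more than `k` occurrences, the first of them in `[u, v)`,
lead up to it. -/
def IsReported (s : ℕ → ℕ) (k r u v j : ℕ) : Prop :=
  k < freq s (s j) j (r + 1) ∨ k < freq s (s j) u (j + 1) ∧ freq s (s j) v (j + 1) ≤ k

section
variable {s : ℕ → ℕ} {n l r u v f k x i j : ℕ}

/-- Look at the first and the last occurrence of a most frequent character. If the first is outside,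
the forward count there sees all occurrences; if the last is, the backward count does; if neither
is, all occurrences lie in `[u, v)`. -/
theorem maxFreq_le_of_outside (h : IsPart n l r u v) (hf : maxFreq s n u v ≤ f)
    (hj : ∀ j, IsOutside l r u v j →
      freq s (s j) j (r + 1) ≤ f ∧ freq s (s j) l (j + 1) ≤ f) :
    maxFreq s n l (r + 1) ≤ f := by
  have hn := h.lt
  have hl := h.left
  have hr := h.right
  obtain ⟨x, hx⟩ := exists_freq_eq_maxFreq s (show 0 < n by omega) l (r + 1)
  rw [← hx]
  by_contra hlt
  unfold freq at hlt hj
  obtain ⟨j₁, h1, h2, h3, h4⟩ := exists_occ (s := s) (x := x) (a := l) (b := r + 1)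
    (k := occ s x l) (by omega) (by omega)
  obtain ⟨j₂, h5, h6, h7, h8⟩ := exists_occ (s := s) (x := x) (a := l) (b := r + 1)
    (k := occ s x (r + 1) - 1) (by omega) (by omega)
  by_cases ho : j₁ < u ∨ v ≤ j₁
  · have := (hj j₁ ⟨h1, by omega, ho⟩).1
    rw [h3] at this
    omega
  by_cases ho' : j₂ < u ∨ v ≤ j₂
  · have := (hj j₂ ⟨h5, by omega, ho'⟩).2
    have h9 := occ_succ_self s j₂
    rw [h7] at this h9
    omega
  have h9 := (freq_le_maxFreq (show v ≤ n by omega) s x u).trans hf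
  have h10 := occ_mono s x (show u ≤ j₁ by omega)
  have h11 := occ_mono s x (show j₂ + 1 ≤ v by omega)
  have h12 := occ_succ_self s j₂
  rw [h7] at h12
  unfold freq at h9
  omega

/-- Bounds how often the scan can raise `f`. -/
theorem maxFreq_le_add (h : IsPart n l r u v) :
    maxFreq s n l (r + 1) ≤ maxFreq s n u v + (u - l) + (r + 1 - v) := by
  have hn := h.lt
  have hl := h.left
  have hr := h.right
  obtain ⟨x, hx⟩ := exists_freq_eq_maxFreq s (show 0 < n by omega) l (r + 1)
  rw [← hx]
  have h1 := freq_le_maxFreq (show v ≤ n by omega) s x u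
  unfold freq at h1 ⊢
  rcases h.order with ho | ho
  · have h2 := occ_sub_le s x hl
    have h3 := occ_sub_le s x hr
    omega
  · by_cases hlr : l ≤ r + 1
    · have h2 := occ_sub_le s x hlr
      omega
    · have h2 := occ_mono s x (show r + 1 ≤ l by omega)
      omega

theorem freq_mono {a b a' b' : ℕ} (s : ℕ → ℕ) (x : ℕ) (ha : a' ≤ a) (hb : b ≤ b') :
    freq s x a b ≤ freq s x a' b' := by
  have h1 := occ_mono s x ha
  have h2 := occ_mono s x hb
  unfold freq
  omega

theorem IsReported.freq_eq (h : IsPart n l r u v) (hk : maxFreq s n l (r + 1) = k + 1)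
    (hj : IsOutside l r u v j) (hr : IsReported s k r u v j) : freq s (s j) l (r + 1) = k + 1 := by
  have h1 := freq_le_maxFreq (show r + 1 ≤ n from h.lt) s (s j) l
  have h2 := freq_mono s (s j) hj.1 (le_refl (r + 1))
  have h3 := freq_mono s (s j) h.left (show j + 1 ≤ r + 1 from Nat.succ_le_succ hj.2.1)
  rcases hr with hr | hr <;> omega

/-- A position reported by the forward clause is the first occurrence in `[l, r]`, one reported by
the backward clause the last. So only `i` forward and `j` backward remains; then all occurrences
start in `[u, v)`, while `i` is the first of them and lies outside. -/
theorem IsReported.not_lt_of_eq (h : IsPart n l r u v) (hk : maxFreq s n l (r + 1) = k + 1)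
    (hi : IsOutside l r u v i) (hj : IsOutside l r u v j) (hri : IsReported s k r u v i)
    (hrj : IsReported s k r u v j) (hs : s i = s j) : ¬ i < j := by
  intro hij
  have h1 := freq_le_maxFreq (show r + 1 ≤ n from h.lt) s (s j) l
  have hi1 := occ_succ_self s i
  have hj1 := occ_succ_self s j
  obtain ⟨hi2, hi3, hi4⟩ := hi
  obtain ⟨hj2, hj3, hj4⟩ := hj
  have hl := h.left
  have ho := h.order
  unfold IsReported at hri hrj
  rw [hs] at hri hi1
  have m1 := occ_mono s (s j) hi2
  have m2 := occ_mono s (s j) (show i + 1 ≤ j from hij)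
  have m3 := occ_mono s (s j) (show j + 1 ≤ r + 1 by omega)
  have m4 := occ_mono s (s j) hl
  unfold freq at *
  rcases hri with hri | hri
  · rcases hrj with hrj | hrj
    · omega
    · by_cases hiu : i < u
      · have m5 := occ_mono s (s j) (show i + 1 ≤ u from hiu)
        omega
      · have m5 := occ_mono s (s j) (show v ≤ i by omega)
        by_cases huv : u ≤ v
        · have m6 := occ_mono s (s j) huv
          omega
        · omega
  · rcases hrj with hrj | hrj <;> omega

theorem IsReported.inj (h : IsPart n l r u v) (hk : maxFreq s n l (r + 1) = k + 1)
    (hi : IsOutside l r u v i) (hj : IsOutside l r u v j) (hri : IsReported s k r u v i)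
    (hrj : IsReported s k r u v j) (hs : s i = s j) : i = j :=
  le_antisymm (not_lt.1 (IsReported.not_lt_of_eq h hk hj hi hrj hri hs.symm))
    (not_lt.1 (IsReported.not_lt_of_eq h hk hi hj hri hrj hs))

theorem exists_isReported_iff (h : IsPart n l r u v) (hk : maxFreq s n l (r + 1) = k + 1) (x : ℕ) :
    (∃ j, IsOutside l r u v j ∧ IsReported s k r u v j ∧ s j = x) ↔
      freq s x l (r + 1) = k + 1 ∧ ∃ j, IsOutside l r u v j ∧ s j = x := by
  constructor
  · rintro ⟨j, hj, hr, rfl⟩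
    exact ⟨hr.freq_eq h hk hj, j, hj, rfl⟩
  · rintro ⟨hx, j, ⟨hj1, hj2, hj3⟩, hj⟩
    have hl := h.left
    have ho := h.order
    unfold freq at hx
    obtain ⟨j₁, h1, h2, h3, h4⟩ := exists_occ (s := s) (x := x) (a := l) (b := r + 1)
      (k := occ s x l) (by omega) (by omega)
    obtain ⟨j₂, h5, h6, h7, h8⟩ := exists_occ (s := s) (x := x) (a := l) (b := r + 1)
      (k := occ s x (r + 1) - 1) (by omega) (by omega)
    have hs1 := occ_succ_self s j₁
    have hs2 := occ_succ_self s j₂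
    have hs3 := occ_succ_self s j
    rw [h3] at hs1
    rw [h7] at hs2
    rw [hj] at hs3
    by_cases hc : j₁ < u ∨ v ≤ j₁
    · refine ⟨j₁, ⟨h1, by omega, hc⟩, .inl ?_, h3⟩
      rw [h3]
      unfold freq
      omega
    -- The first occurrence is in `[u, v)` and `j` is outside, so `j`, and with it the last
    -- occurrence `j₂`, is at or behind `v`; hence `j₂` is reported by the backward clause.
    · have hj₁ : j₁ ≤ j := by
        by_contra hlt
        have := occ_mono s x (show j + 1 ≤ j₁ by omega)
        have := occ_mono s x hj1
        omega
      have hj₂ : j ≤ j₂ := by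
        by_contra hlt
        have := occ_mono s x (show j₂ + 1 ≤ j by omega)
        have := occ_mono s x (show j + 1 ≤ r + 1 by omega)
        omega
      refine ⟨j₂, ⟨h5, by omega, by omega⟩, .inr ?_, h7⟩
      rw [h7]
      have := occ_mono s x (show j₁ + 1 ≤ v by omega)
      have := occ_mono s x (show u ≤ j₁ by omega)
      unfold freq
      omega

/-- An outside occurrence on top of `k + 1` in `[u, v)` would exceed the maximum. With
`exists_isReported_iff` this splits the modes into two disjoint classes. -/
theorem lt_freq_part_iff (h : IsPart n l r u v) (hk : maxFreq s n l (r + 1) = k + 1) (x : ℕ) :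
    k < freq s x u v ↔
      freq s x l (r + 1) = k + 1 ∧ ¬ ∃ j, IsOutside l r u v j ∧ s j = x := by
  have h0 := freq_le_maxFreq (show r + 1 ≤ n from h.lt) s x l
  constructor
  · intro hx
    have h1 := freq_mono s x h.left h.right
    refine ⟨by omega, ?_⟩
    rintro ⟨j, ⟨h2, h3, h4⟩, rfl⟩
    have m1 := occ_mono s (s j) h.left
    have m2 := occ_mono s (s j) h.right
    have m3 := occ_succ_self s j
    have m4 := occ_mono s (s j) h2
    have m5 := occ_mono s (s j) (show j + 1 ≤ r + 1 from Nat.succ_le_succ h3)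
    unfold freq at *
    rcases h4 with h4 | h4
    · have := occ_mono s (s j) (show j + 1 ≤ u from h4)
      omega
    · have := occ_mono s (s j) h4
      omega
  · rintro ⟨hx, ho⟩
    unfold freq at hx ⊢
    obtain ⟨j₁, h1, h2, h3, h4⟩ := exists_occ (s := s) (x := x) (a := l) (b := r + 1)
      (k := occ s x l) (by omega) (by omega)
    obtain ⟨j₂, h5, h6, h7, h8⟩ := exists_occ (s := s) (x := x) (a := l) (b := r + 1)
      (k := occ s x (r + 1) - 1) (by omega) (by omega)
    have hc1 : ¬ (j₁ < u ∨ v ≤ j₁) := fun hc => ho ⟨j₁, ⟨h1, by omega, hc⟩, h3⟩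
    have hc2 : ¬ (j₂ < u ∨ v ≤ j₂) := fun hc => ho ⟨j₂, ⟨h5, by omega, hc⟩, h7⟩
    have hs2 := occ_succ_self s j₂
    rw [h7] at hs2
    have := occ_mono s x (show u ≤ j₁ by omega)
    have := occ_mono s x (show j₂ + 1 ≤ v by omega)
    omega

theorem lt_freq_succ_iff (s : ℕ → ℕ) (k x u j : ℕ) :
    k < freq s x u (j + 1) ↔ k < freq s x u j ∨ x = s j ∧ k < freq s (s j) u (j + 1) := by
  have h := occ_succ s x j
  by_cases hx : s j = x
  · subst hx
    rw [if_pos rfl] at h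
    unfold freq
    omega
  · rw [if_neg hx] at h
    have : x ≠ s j := fun h => hx h.symm
    simp only [this, false_and, or_false]
    unfold freq
    omega

end

/-! ### Correctness of the query program -/

/-- `D` is an index for the string `s` of length `n` with block size `b` and tables with rows of
length `M`. -/
structure IsIndex (w n : ℕ) (s : ℕ → ℕ) (b M : ℕ) (D : List ℕ) : Prop where
  pos : 0 < b
  le : b ≤ n
  word : 20 * n + 20 < 2 ^ w
  word' : M * (M * 5) + M * 5 + 20 < 2 ^ w
  block : D.getD 0 0 % 2 ^ w = b
  row : D.getD 5 0 % 2 ^ w = M * 5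
  rank : ∀ i < n, D.getD (i * 5 + 1) 0 % 2 ^ w = rank s n i * 5 + 2
  posOfRank : ∀ k < 3 * n, D.getD (k * 5 + 2) 0 % 2 ^ w = posOfRank s n k
  freq : ∀ L < M, ∀ R < M, R * b ≤ n →
    D.getD (R * 5 + (L * (M * 5) + 3)) 0 % 2 ^ w = maxFreq s n (L * b) (R * b) * 5
  last : ∀ L < M, ∀ R < M, R * b ≤ n →
    D.getD (R * 5 + (L * (M * 5) + 3) + 1) 0 % 2 ^ w = lastMode s n (L * b) (R * b)

/-- `[l, r]` is a range of a string of length `n`, and its full blocks of length `b` are those with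
numbers from `L` to `R - 1`. -/
structure IsQuery (n b M l r L R : ℕ) : Prop where
  le : l ≤ r
  lt : r < n
  rowL : L < M
  rowR : R < M
  left : l ≤ L * b
  left' : L * b < l + b
  right : R * b ≤ r + 1
  right' : r + 1 < R * b + b
  -- If the range contains no block boundary, `r + 1 < L * b` must be strict: a loop that reached `L
  -- * b` would jump back to `R * b`.
  order : L * b ≤ R * b ∨ R * b < l ∧ r + 1 < L * b

theorem IsQuery.isPart {n b M l r L R : ℕ} (h : IsQuery n b M l r L R) :
    IsPart n l r (L * b) (R * b) :=
  ⟨h.lt, h.left, h.right, h.order⟩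

/-- The registers during a query. -/
def queryRegs (l r b M L R f i t x q g y h p : ℕ) : List ℕ :=
  [l, r, 1, 5, b, M * 5, L * b, R * b, f * 5, i, t, x, q, L * (M * 5) + 3, g * 5, y, h, 0, p]

section
variable {w n : ℕ} {S : Fin n → ℕ} {D work out o : List ℕ}
  {b M l r L R f i t x q g y h p T k : ℕ}

/-- Ranks are stored as addresses in the table of positions and frequencies as multiples of the
stride `5`, so one addition moves by `f` entries. -/
theorem IsIndex.readForward {s : ℕ → ℕ} (hD : IsIndex w n s b M D) (hi : i < n) (hf : f ≤ n) :
    D.getD (RangeMode.rank s n i * 5 + 2 + f * 5) 0 % 2 ^ w =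
      RangeMode.posOfRank s n (RangeMode.rank s n i + f) := by
  have := rank_lt (s := s) hi
  rw [← hD.posOfRank _ (by omega)]
  congr 2
  ring

theorem IsIndex.readBackward {s : ℕ → ℕ} (hD : IsIndex w n s b M D) (hi : i < n) (hf : f ≤ n) :
    D.getD (RangeMode.rank s n i * 5 + 2 - f * 5) 0 % 2 ^ w =
      RangeMode.posOfRank s n (RangeMode.rank s n i - f) := by
  have := rank_lt (s := s) hi
  have := le_rank s n i
  rw [← hD.posOfRank _ (by omega)]
  congr 2
  omega

/-- One iteration of the loop that finds the largest frequency: `f` is raised if the character at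
position `i` occurs more than `f` times from `i` to `r` or from `l` to `i`. -/
theorem ends_scan (hS : ∀ i, S i < 2 ^ w) (hD : IsIndex w n (charAt S) b M D)
    (hQ : IsQuery n b M l r L R) (hl : l ≤ i) (hr : i ≤ r) (hf : f ≤ n)
    (hsucc : f < freq (charAt S) (charAt S i) i (r + 1) ∨
        f < freq (charAt S) (charAt S i) l (i + 1) →
      ∀ t x q y, Ends queryProgram w S D
        (st 20 (queryRegs l r b M L R (f + 1) i t x q g y h p) work out) T o)
    (hfail : freq (charAt S) (charAt S i) i (r + 1) ≤ f →
        freq (charAt S) (charAt S i) l (i + 1) ≤ f →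
      ∀ t x q y, Ends queryProgram w S D
        (st 20 (queryRegs l r b M L R f (i + 1) t x q g y h p) work out) T o) :
    Ends queryProgram w S D (st 24 (queryRegs l r b M L R f i t x q g y h p) work out) (T + 20)
      o := by
  have := hD.word
  have hrn := hQ.lt
  have hin : i < n := by omega
  have hrk := rank_lt (s := charAt S) hin
  have hrk' := le_rank (charAt S) n i
  have h1 := posOfRank_add_lt_iff (s := charAt S) (n := n) (i := i) (k := f) (b := r + 1) (by omega)
  have h2 := le_posOfRank_sub_iff (s := charAt S) (n := n) (i := i) (k := f) (a := l) hin hf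
  have h3 := le_posOfRank_add (s := charAt S) (n := n) (i := i) (k := f)
  have h4 := posOfRank_sub_le (s := charAt S) (n := n) (i := i) (k := f) hf
  have hF := hD.readForward hin hf
  have hB := hD.readBackward hin hf
  generalize posOfRank (charAt S) n (rank (charAt S) n i + f) = q₁ at *
  generalize posOfRank (charAt S) n (rank (charAt S) n i - f) = q₂ at *
  have hS' : (f + 1) * 5 = f * 5 + 5 := by ring
  unfold queryRegs at *
  rw [hS'] at hsucc
  -- The exits common to several branches: `succ` raises `f`, `fail` advances the position, and
  -- `back` starts the backward test.
  have succ (hc : f < freq (charAt S) (charAt S i) i (r + 1) ∨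
      f < freq (charAt S) (charAt S i) l (i + 1)) (t x q y : ℕ) : Ends queryProgram w S D
        (st 42 [l, r, 1, 5, b, M * 5, L * b, R * b, f * 5, i, t, x, q, L * (M * 5) + 3, g * 5, y,
          h, 0, p] work out) (T + 2) o := by
    refine ends_add rfl rfl ?_ ?_
    · simp; omega
    refine ends_jump rfl ?_
    simp only [List.getD_cons_succ, List.getD_cons_zero, List.set_cons_succ, List.set_cons_zero]
    exact hsucc hc ..
  have fail (hc : freq (charAt S) (charAt S i) i (r + 1) ≤ f)
      (hc' : freq (charAt S) (charAt S i) l (i + 1) ≤ f) (t x q y : ℕ) : Ends queryProgram w S D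
        (st 40 [l, r, 1, 5, b, M * 5, L * b, R * b, f * 5, i, t, x, q, L * (M * 5) + 3, g * 5, y,
          h, 0, p] work out) (T + 2) o := by
    refine ends_add rfl rfl ?_ ?_
    · simp; omega
    refine ends_jump rfl ?_
    simp only [List.getD_cons_succ, List.getD_cons_zero, List.set_cons_succ, List.set_cons_zero]
    exact hfail hc hc' ..
  have back (hc : freq (charAt S) (charAt S i) i (r + 1) ≤ f) (x q : ℕ) : Ends queryProgram w S D
        (st 34 [l, r, 1, 5, b, M * 5, L * b, R * b, f * 5, i, rank (charAt S) n i * 5 + 2, x, q,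
          L * (M * 5) + 3, g * 5, charAt S i, h, 0, p] work out) (T + 8) o := by
    refine ends_sub rfl rfl ?_ ?_ ?_
    · simp; omega
    · simp; omega
    refine ends_readIndex rfl rfl hB ?_
    simp only [List.getD_cons_succ, List.getD_cons_zero, List.set_cons_succ, List.set_cons_zero]
    refine ends_jumpLt rfl (fun hc1 => ?_) fun hc1 => ends_jumpLt rfl (fun hc2 => ?_) fun hc2 =>
      ends_readInput hS rfl rfl (ends_jumpEq rfl (fun hc3 => ?_) fun hc3 => ?_)
    all_goals
      simp only [List.getD_cons_succ, List.getD_cons_zero, List.set_cons_succ,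
        List.set_cons_zero] at *
    · exact (fail hc (by by_contra hx; have := h2.2 (by omega); omega) ..).mono (by omega)
    · exact (fail hc (by by_contra hx; have := h2.2 (by omega); have := h4 this.2.1 this.2.2; omega)
        ..).mono (by omega)
    · exact (succ (.inr (h2.1 ⟨hc1, by omega, hc3⟩)) ..).mono (by omega)
    · exact (fail hc (by by_contra hx; exact hc3 (h2.2 (by omega)).2.2) ..).mono (by omega)
  refine ends_mul rfl rfl ?_ ?_
  · simp; omega
  refine ends_add rfl rfl ?_ ?_
  · simp; omega
  refine ends_readIndex rfl rfl (hD.rank i hin) ?_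
  refine ends_readInput hS rfl rfl ?_
  refine ends_add rfl rfl ?_ ?_
  · simp; omega
  refine ends_readIndex rfl rfl hF ?_
  simp only [List.getD_cons_succ, List.getD_cons_zero, List.set_cons_succ, List.set_cons_zero]
  refine ends_jumpLt rfl (fun hc1 => ?_) fun hc1 => ends_jumpLt rfl (fun hc2 => ?_) fun hc2 =>
    ends_readInput hS rfl rfl (ends_jumpEq rfl (fun hc3 => ?_) fun hc3 => ?_)
  all_goals
    simp only [List.getD_cons_succ, List.getD_cons_zero, List.set_cons_succ,
      List.set_cons_zero] at *
  · refine (back ?_ ..).mono (by omega)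
    by_contra hx
    have h5 := h1.2 (by omega)
    -- A hit never lies before `i ≥ l`, so the comparison with `l` rejects none.
    have := h3 (by omega) h5.2
    omega
  · refine (back ?_ ..).mono (by omega)
    by_contra hx
    have h5 := h1.2 (by omega)
    omega
  · exact (succ (.inl (h1.1 ⟨by omega, hc3⟩)) ..).mono (by omega)
  · refine (back ?_ ..).mono (by omega)
    by_contra hx
    exact hc3 (h1.2 (by omega)).2
/-- The head of the two loops over the positions outside of the full blocks. -/
theorem ends_skip {pc pc' : ℕ} (h₀ : queryProgram[pc]? = some (.jumpEq 9 6 (pc + 2)))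
    (h₁ : queryProgram[pc + 1]? = some (.jump (pc + 3)))
    (h₂ : queryProgram[pc + 2]? = some (.op .add 9 7 17))
    (h₃ : queryProgram[pc + 3]? = some (.jumpLt 1 9 pc'))
    (hD : IsIndex w n (charAt S) b M D) (hQ : IsQuery n b M l r L R)
    (hexit : r < (if i = L * b then R * b else i) → Ends queryProgram w S D
      (st pc' (queryRegs l r b M L R f (if i = L * b then R * b else i) t x q g y h p) work out)
      T o)
    (hcont : (if i = L * b then R * b else i) ≤ r → Ends queryProgram w S D
      (st (pc + 4) (queryRegs l r b M L R f (if i = L * b then R * b else i) t x q g y h p) work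
        out) T o) :
    Ends queryProgram w S D (st pc (queryRegs l r b M L R f i t x q g y h p) work out) (T + 3)
      o := by
  have := hD.word
  have := hQ.right
  have := hQ.lt
  unfold queryRegs at *
  refine ends_jumpEq h₀ (fun hc => ?_) fun hc => ?_
  · simp only [List.getD_cons_succ, List.getD_cons_zero] at hc
    rw [if_pos hc] at *
    refine ends_add h₂ rfl ?_ ?_
    · simp; omega
    simp only [List.getD_cons_succ, List.getD_cons_zero, List.set_cons_succ, List.set_cons_zero,
      add_zero]
    exact ends_jumpLt h₃ hexit hcont
  · simp only [List.getD_cons_succ, List.getD_cons_zero] at hc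
    rw [if_neg hc] at *
    exact ends_jump h₁ (ends_jumpLt h₃ hexit hcont)

/-- The first loop computes the largest frequency. -/
theorem ends_scanLoop (hS : ∀ i, S i < 2 ^ w) (hD : IsIndex w n (charAt S) b M D)
    (hQ : IsQuery n b M l r L R)
    (hcont : ∀ i t x q y, Ends queryProgram w S D
      (st 44 (queryRegs l r b M L R (maxFreq (charAt S) n l (r + 1)) i t x q g y h p) work out) T o)
    (k i f t x q y : ℕ) (hl : l ≤ i) (hr : i ≤ r + 1) (hi : i ≤ L * b ∨ R * b ≤ i)
    (hf : f ≤ maxFreq (charAt S) n l (r + 1))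
    (hdone : ∀ j, IsOutside l r (L * b) (R * b) j → j < i →
      freq (charAt S) (charAt S j) j (r + 1) ≤ f ∧ freq (charAt S) (charAt S j) l (j + 1) ≤ f)
    (hB : maxFreq (charAt S) n (L * b) (R * b) ≤ f)
    (hk : L * b - i + (r + 1 - max i (R * b)) + (maxFreq (charAt S) n l (r + 1) - f) ≤ k) :
    Ends queryProgram w S D (st 20 (queryRegs l r b M L R f i t x q g y h p) work out)
      (T + 23 * k + 23) o := by
  -- Every iteration either advances the position or raises `f`, and both decrease the measure
  -- bounded by `k`.
  induction k using Nat.strong_induction_on generalizing i f t x q y with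
  | _ k ih =>
  have ho := hQ.order
  have hrn := hQ.lt
  have hle := hQ.le
  have hql := hQ.left
  have hqr := hQ.right
  refine (ends_skip (T := T + 23 * k + 20) rfl rfl rfl rfl hD hQ ?_ ?_).mono (by omega)
  all_goals
    generalize hi' : (if i = L * b then R * b else i) = i'
    have hii : i = L * b ∧ i' = R * b ∨ i ≠ L * b ∧ i' = i := by
      split_ifs at hi' with hc
      · exact .inl ⟨hc, hi'.symm⟩
      · exact .inr ⟨hc, hi'.symm⟩
    clear hi'
    have hdone' : ∀ j, IsOutside l r (L * b) (R * b) j → j < i' →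
        freq (charAt S) (charAt S j) j (r + 1) ≤ f ∧
          freq (charAt S) (charAt S j) l (j + 1) ≤ f := by
      intro j hj hji
      refine hdone j hj ?_
      have := hj.2.2
      omega
  · intro hc
    have : maxFreq (charAt S) n l (r + 1) ≤ f :=
      maxFreq_le_of_outside hQ.isPart hB fun j hj => hdone' j hj (by have := hj.2.1; omega)
    obtain rfl : f = maxFreq (charAt S) n l (r + 1) := by omega
    exact (hcont ..).mono (by omega)
  · intro hc
    have hfn := maxFreq_le (charAt S) n l (r + 1)
    have hio : IsOutside l r (L * b) (R * b) i' := ⟨by omega, hc, by omega⟩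
    refine ends_scan (T := T + 23 * k) hS hD hQ hio.1 hc (by omega) ?_ ?_
    · intro hs t x q y
      have h1 := freq_le_maxFreq (show r + 1 ≤ n by omega) (charAt S) (charAt S i') l
      have h2 := freq_mono (charAt S) (charAt S i') hio.1 (le_refl (r + 1))
      have h3 := freq_mono (charAt S) (charAt S i') (le_refl l) (show i' + 1 ≤ r + 1 by omega)
      have hfF : f < maxFreq (charAt S) n l (r + 1) := by omega
      refine (ih (k - 1) (by omega) i' (f + 1) t x q y hio.1 (by omega) (by omega) (by omega)
        ?_ (by omega) (by omega)).mono (by omega)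
      intro j hj hji
      have := hdone' j hj hji
      omega
    · intro h1 h2 t x q y
      refine (ih (k - 1) (by omega) (i' + 1) f t x q y (by omega) (by omega) (by omega) hf
        ?_ hB (by omega)).mono (by omega)
      intro j hj hji
      by_cases hj' : j = i'
      · subst hj'; exact ⟨h1, h2⟩
      · exact hdone' j hj (by omega)

/-- One iteration of the loop that outputs the modes that occur outside of the full blocks. -/
theorem ends_report (hS : ∀ i, S i < 2 ^ w) (hD : IsIndex w n (charAt S) b M D)
    (hQ : IsQuery n b M l r L R) (hl : l ≤ i) (hr : i ≤ r) (hk : k ≤ n)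
    (hsucc : IsReported (charAt S) k r (L * b) (R * b) i →
      ∀ t x q y, Ends queryProgram w S D
        (st 46 (queryRegs l r b M L R f (i + 1) t x q g y (k * 5) p) work (out ++ [charAt S i]))
        T o)
    (hfail : ¬ IsReported (charAt S) k r (L * b) (R * b) i →
      ∀ t x q y, Ends queryProgram w S D
        (st 46 (queryRegs l r b M L R f (i + 1) t x q g y (k * 5) p) work out) T o) :
    Ends queryProgram w S D (st 50 (queryRegs l r b M L R f i t x q g y (k * 5) p) work out)
      (T + 20) o := by
  have := hD.word
  have hrn := hQ.lt
  have hqr := hQ.right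
  have hin : i < n := by omega
  have hrk := rank_lt (s := charAt S) hin
  have hrk' := le_rank (charAt S) n i
  have h1 := posOfRank_add_lt_iff (s := charAt S) (n := n) (i := i) (k := k) (b := r + 1) (by omega)
  have h2 := le_posOfRank_sub_iff (s := charAt S) (n := n) (i := i) (k := k) (a := L * b) hin hk
  have h2' := le_posOfRank_sub_iff (s := charAt S) (n := n) (i := i) (k := k) (a := R * b) hin hk
  have h3 := le_posOfRank_add (s := charAt S) (n := n) (i := i) (k := k)
  have hF := hD.readForward hin hk
  have hB := hD.readBackward hin hk
  unfold IsReported at hsucc hfail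
  generalize posOfRank (charAt S) n (rank (charAt S) n i + k) = q₁ at *
  generalize posOfRank (charAt S) n (rank (charAt S) n i - k) = q₂ at *
  unfold queryRegs at *
  have fail (hc : ¬ (k < freq (charAt S) (charAt S i) i (r + 1) ∨
      k < freq (charAt S) (charAt S i) (L * b) (i + 1) ∧
        freq (charAt S) (charAt S i) (R * b) (i + 1) ≤ k)) (t x q y : ℕ) :
      Ends queryProgram w S D
        (st 67 [l, r, 1, 5, b, M * 5, L * b, R * b, f * 5, i, t, x, q, L * (M * 5) + 3, g * 5, y,
          k * 5, 0, p] work out) (T + 2) o := by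
    refine ends_add rfl rfl ?_ ?_
    · simp; omega
    refine ends_jump rfl ?_
    simp only [List.getD_cons_succ, List.getD_cons_zero, List.set_cons_succ, List.set_cons_zero]
    exact hfail hc ..
  have succ (hc : k < freq (charAt S) (charAt S i) i (r + 1) ∨
      k < freq (charAt S) (charAt S i) (L * b) (i + 1) ∧
        freq (charAt S) (charAt S i) (R * b) (i + 1) ≤ k) (t x q : ℕ) : Ends queryProgram w S D
        (st 69 [l, r, 1, 5, b, M * 5, L * b, R * b, f * 5, i, t, x, q, L * (M * 5) + 3, g * 5,
          charAt S i, k * 5, 0, p] work out) (T + 4) o := by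
    refine ends_emit rfl (ends_jump rfl (ends_add rfl rfl ?_ (ends_jump rfl ?_)))
    · simp; omega
    simp only [List.getD_cons_succ, List.getD_cons_zero, List.set_cons_succ, List.set_cons_zero]
    exact hsucc hc ..
  have back (hc : freq (charAt S) (charAt S i) i (r + 1) ≤ k) (x q : ℕ) : Ends queryProgram w S D
        (st 60 [l, r, 1, 5, b, M * 5, L * b, R * b, f * 5, i, rank (charAt S) n i * 5 + 2, x, q,
          L * (M * 5) + 3, g * 5, charAt S i, k * 5, 0, p] work out) (T + 10) o := by
    refine ends_sub rfl rfl ?_ ?_ ?_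
    · simp; omega
    · simp; omega
    refine ends_readIndex rfl rfl hB ?_
    simp only [List.getD_cons_succ, List.getD_cons_zero, List.set_cons_succ, List.set_cons_zero]
    refine ends_jumpLt rfl (fun hc1 => ?_) fun hc1 => ends_jumpLt rfl (fun hc2 =>
      ends_readInput hS rfl rfl (ends_jumpEq rfl (fun hc3 => ?_) fun hc3 => ?_)) fun hc2 =>
      ends_jump rfl ?_
    all_goals
      simp only [List.getD_cons_succ, List.getD_cons_zero, List.set_cons_succ,
        List.set_cons_zero] at *
    · exact (fail (by rintro (hx | hx); · omega
                      have := h2.2 hx.1; omega) ..).mono (by omega)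
    · refine (succ (.inr ⟨h2.1 ⟨hc1, by omega, hc3⟩, ?_⟩) ..).mono (by omega)
      by_contra hx
      have := h2'.2 (by omega)
      omega
    · exact (fail (by rintro (hx | hx); · omega
                      exact hc3 (h2.2 hx.1).2.2) ..).mono (by omega)
    · refine (fail ?_ ..).mono (by omega)
      rintro (hx | hx)
      · omega
      -- Here `q₂` is at or behind `R * b`, so a match would give more than `k` occurrences from
      -- there on, against the second clause of `IsReported`.
      · have h5 := h2.2 hx.1
        have := h2'.1 ⟨hc2, h5.2⟩
        omega
  refine ends_mul rfl rfl ?_ ?_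
  · simp; omega
  refine ends_add rfl rfl ?_ ?_
  · simp; omega
  refine ends_readIndex rfl rfl (hD.rank i hin) ?_
  refine ends_readInput hS rfl rfl ?_
  refine ends_add rfl rfl ?_ ?_
  · simp; omega
  refine ends_readIndex rfl rfl hF ?_
  simp only [List.getD_cons_succ, List.getD_cons_zero, List.set_cons_succ, List.set_cons_zero]
  refine ends_jumpLt rfl (fun hc1 => ?_) fun hc1 => ends_jumpLt rfl (fun hc2 => ?_) fun hc2 =>
    ends_readInput hS rfl rfl (ends_jumpEq rfl (fun hc3 => ?_) fun hc3 => ?_)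
  all_goals
    simp only [List.getD_cons_succ, List.getD_cons_zero, List.set_cons_succ,
      List.set_cons_zero] at *
  · refine (back ?_ ..).mono (by omega)
    by_contra hx
    have h5 := h1.2 (by omega)
    have := h3 (by omega) h5.2
    omega
  · refine (back ?_ ..).mono (by omega)
    by_contra hx
    have h5 := h1.2 (by omega)
    omega
  · exact (succ (.inl (h1.1 ⟨by omega, hc3⟩)) ..).mono (by omega)
  · refine (back ?_ ..).mono (by omega)
    by_contra hx
    exact hc3 (h1.2 (by omega)).2

/-- The second loop outputs the modes that occur outside of the full blocks. -/
theorem ends_reportLoop (hS : ∀ i, S i < 2 ^ w) (hD : IsIndex w n (charAt S) b M D)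
    (hQ : IsQuery n b M l r L R) (hk : maxFreq (charAt S) n l (r + 1) = k + 1)
    (m i : ℕ) (out : List ℕ) (hl : l ≤ i) (hr : i ≤ r + 1) (hi : i ≤ L * b ∨ R * b ≤ i)
    (hnd : out.Nodup)
    (hout : ∀ x, x ∈ out ↔ ∃ j, j < i ∧ IsOutside l r (L * b) (R * b) j ∧
      IsReported (charAt S) k r (L * b) (R * b) j ∧ charAt S j = x)
    (hm : L * b - i + (r + 1 - max i (R * b)) ≤ m) :
    -- The list is chosen before the continuation and the registers, so that it can be prepended to
    -- the output of the last loop.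
    ∃ out' : List ℕ, out'.Nodup ∧
      (∀ x, x ∈ out' ↔ ∃ j, IsOutside l r (L * b) (R * b) j ∧
        IsReported (charAt S) k r (L * b) (R * b) j ∧ charAt S j = x) ∧
      ∀ f g p o T, (∀ i t x q y, Ends queryProgram w S D
          (st 71 (queryRegs l r b M L R f i t x q g y (k * 5) p) work out') T o) →
        ∀ t x q y, Ends queryProgram w S D
          (st 46 (queryRegs l r b M L R f i t x q g y (k * 5) p) work out) (T + 23 * m + 23) o := by
  induction m using Nat.strong_induction_on generalizing i out with
  | _ m ih =>
  have ho := hQ.order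
  have hrn := hQ.lt
  have hle := hQ.le
  have hql := hQ.left
  have hqr := hQ.right
  have hkn := maxFreq_le (charAt S) n l (r + 1)
  obtain ⟨i', hi'⟩ : ∃ i', (if i = L * b then R * b else i) = i' := ⟨_, rfl⟩
  have hii : i = L * b ∧ i' = R * b ∨ i ≠ L * b ∧ i' = i := by
    split_ifs at hi' with hc
    · exact .inl ⟨hc, hi'.symm⟩
    · exact .inr ⟨hc, hi'.symm⟩
  have hout' : ∀ x, x ∈ out ↔ ∃ j, j < i' ∧ IsOutside l r (L * b) (R * b) j ∧
      IsReported (charAt S) k r (L * b) (R * b) j ∧ charAt S j = x := by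
    intro x
    rw [hout]
    constructor
    · rintro ⟨j, h1, h2, h3⟩
      exact ⟨j, by omega, h2, h3⟩
    · rintro ⟨j, h1, h2, h3⟩
      have := h2.2.2
      exact ⟨j, by omega, h2, h3⟩
  by_cases hc : i' ≤ r
  · have hio : IsOutside l r (L * b) (R * b) i' := ⟨by omega, hc, by omega⟩
    obtain ⟨out'', hnd'', hout'', hE⟩ : ∃ out'' : List ℕ, out''.Nodup ∧
        (∀ x, x ∈ out'' ↔ ∃ j, j < i' + 1 ∧ IsOutside l r (L * b) (R * b) j ∧
          IsReported (charAt S) k r (L * b) (R * b) j ∧ charAt S j = x) ∧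
        ∀ f g p o T, (∀ t x q y, Ends queryProgram w S D
          (st 46 (queryRegs l r b M L R f (i' + 1) t x q g y (k * 5) p) work out'') T o) →
          ∀ t x q y, Ends queryProgram w S D
            (st 50 (queryRegs l r b M L R f i' t x q g y (k * 5) p) work out) (T + 20) o := by
      by_cases hrep : IsReported (charAt S) k r (L * b) (R * b) i'
      · refine ⟨out ++ [charAt S i'], ?_, fun x => ?_, fun f g p o T hE t x q y =>
          ends_report hS hD hQ hio.1 hc (by omega) (fun _ => hE) fun hx => absurd hrep hx⟩
        · refine List.Nodup.append hnd (List.nodup_singleton _) ?_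
          rw [List.disjoint_singleton]
          intro hx
          obtain ⟨j, h1, h2, h3, h4⟩ := (hout' _).1 hx
          have := IsReported.inj hQ.isPart hk h2 hio h3 hrep h4
          omega
        · rw [List.mem_append, hout', List.mem_singleton]
          constructor
          · rintro (⟨j, h1, h2⟩ | rfl)
            · exact ⟨j, by omega, h2⟩
            · exact ⟨i', by omega, hio, hrep, rfl⟩
          · rintro ⟨j, h1, h2⟩
            by_cases hj : j = i'
            · subst hj; exact .inr h2.2.2.symm
            · exact .inl ⟨j, by omega, h2⟩
      · refine ⟨out, hnd, fun x => ?_, fun f g p o T hE t x q y =>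
          ends_report hS hD hQ hio.1 hc (by omega) (fun hx => absurd hx hrep) fun _ => hE⟩
        rw [hout']
        constructor
        · rintro ⟨j, h1, h2⟩
          exact ⟨j, by omega, h2⟩
        · rintro ⟨j, h1, h2⟩
          refine ⟨j, ?_, h2⟩
          by_contra hj
          obtain rfl : j = i' := by omega
          exact hrep h2.2.1
    obtain ⟨out₃, hnd₃, hout₃, hE₃⟩ := ih (m - 1) (by omega) (i' + 1) out'' (by omega) (by omega)
      (by omega) hnd'' hout'' (by omega)
    refine ⟨out₃, hnd₃, hout₃, fun f g p o T hT t x q y => ?_⟩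
    refine (ends_skip (T := T + 23 * m + 20) rfl rfl rfl rfl hD hQ ?_ ?_).mono (by omega)
    · rw [hi']
      omega
    · rw [hi']
      intro _
      exact (hE f g p o _ (hE₃ f g p o T hT) ..).mono (by omega)
  · refine ⟨out, hnd, fun x => ?_, fun f g p o T hT t x q y => ?_⟩
    · rw [hout']
      constructor
      · rintro ⟨j, h1, h2⟩
        exact ⟨j, h2⟩
      · rintro ⟨j, h2⟩
        have := h2.1.2.1
        exact ⟨j, by omega, h2⟩
    · refine (ends_skip (T := T) rfl rfl rfl rfl hD hQ ?_ ?_).mono (by omega)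
      · intro _
        exact hT ..
      · rw [hi']
        omega

/-- One iteration of the loop that outputs the modes of the full blocks. -/
theorem ends_blockStep (hS : ∀ i, S i < 2 ^ w) (hD : IsIndex w n (charAt S) b M D)
    (hi : i < n) (hk : k ≤ n)
    (hsucc : k < freq (charAt S) (charAt S i) (L * b) (i + 1) →
      ∀ t x q y, Ends queryProgram w S D
        (st 84 (queryRegs l r b M L R f i t x q g y (k * 5) p) work (out ++ [charAt S i])) T o)
    (hfail : ¬ k < freq (charAt S) (charAt S i) (L * b) (i + 1) →
      ∀ t x q y, Ends queryProgram w S D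
        (st 84 (queryRegs l r b M L R f i t x q g y (k * 5) p) work out) T o) :
    Ends queryProgram w S D (st 74 (queryRegs l r b M L R f i t x q g y (k * 5) p) work out)
      (T + 12) o := by
  have := hD.word
  have hrk := rank_lt (s := charAt S) hi
  have hrk' := le_rank (charAt S) n i
  have h2 := le_posOfRank_sub_iff (s := charAt S) (n := n) (i := i) (k := k) (a := L * b) hi hk
  have h4 := posOfRank_sub_le (s := charAt S) (n := n) (i := i) (k := k) hk
  have hB := hD.readBackward hi hk
  generalize posOfRank (charAt S) n (rank (charAt S) n i - k) = q₂ at *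
  unfold queryRegs at *
  refine ends_mul rfl rfl ?_ ?_
  · simp; omega
  refine ends_add rfl rfl ?_ ?_
  · simp; omega
  refine ends_readIndex rfl rfl (hD.rank i hi) ?_
  refine ends_readInput hS rfl rfl ?_
  refine ends_sub rfl rfl ?_ ?_ ?_
  · simp; omega
  · simp; omega
  refine ends_readIndex rfl rfl hB ?_
  simp only [List.getD_cons_succ, List.getD_cons_zero, List.set_cons_succ, List.set_cons_zero]
  refine ends_jumpLt rfl (fun hc1 => ?_) fun hc1 => ends_jumpLt rfl (fun hc2 => ?_) fun hc2 =>
    ends_readInput hS rfl rfl (ends_jumpEq rfl (fun hc3 =>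
      ends_emit rfl (ends_jump rfl ?_)) fun hc3 => ?_)
  all_goals
    simp only [List.getD_cons_succ, List.getD_cons_zero, List.set_cons_succ,
      List.set_cons_zero] at *
  · refine (hfail ?_ ..).mono (by omega)
    intro hx
    have := h2.2 hx
    omega
  · refine (hfail ?_ ..).mono (by omega)
    intro hx
    have h5 := (h2.2 hx).2
    have := h4 h5.1 h5.2
    omega
  · exact hsucc (h2.1 ⟨hc1, by omega, hc3⟩) ..
  · exact (hfail (fun hx => hc3 (h2.2 hx).2.2) ..).mono (by omega)

/-- Whenever the machine arrives at instruction `84` at position `i`, it outputs the characters with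
more than `k` occurrences between `u` and `i`, and stops. -/
def BlockGoal {n : ℕ} (w : ℕ) (S : Fin n → ℕ) (D work : List ℕ) (l r b M L R k i : ℕ) : Prop :=
  ∃ e : List ℕ, e.Nodup ∧ (∀ x, x ∈ e ↔ k < freq (charAt S) x (L * b) i) ∧
    ∀ t x q g y p out, Ends queryProgram w S D
      (st 84 (queryRegs l r b M L R (k + 1) i t x q g y (k * 5) p) work out)
      (20 * (i % b) + 20 * (b + 1) * e.length + 20) (out ++ e)

/-- Since `k + 1` bounds the frequency, a character that reaches it at `i` cannot have reached it
before, so nothing is output twice. The number `m` leaves out an output made at `i` itself, which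
can then pay for the walk to the block boundary. -/
theorem BlockGoal.step (hS : ∀ i, S i < 2 ^ w) (hD : IsIndex w n (charAt S) b M D)
    (hi : i < n) (hk : k ≤ n)
    (hmax : freq (charAt S) (charAt S i) (L * b) (i + 1) ≤ k + 1)
    (hX : BlockGoal w S D work l r b M L R k i) :
    ∃ (e : List ℕ) (m : ℕ), e.Nodup ∧ (∀ x, x ∈ e ↔ k < freq (charAt S) x (L * b) (i + 1)) ∧
      m ≤ e.length ∧ (k < freq (charAt S) (charAt S i) (L * b) (i + 1) → m + 1 = e.length) ∧
      ∀ t x q g y p out, Ends queryProgram w S D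
        (st 74 (queryRegs l r b M L R (k + 1) i t x q g y (k * 5) p) work out)
        (20 * (i % b) + 20 * (b + 1) * m + 32) (out ++ e) := by
  obtain ⟨e, hnd, he, hE⟩ := hX
  by_cases hc : k < freq (charAt S) (charAt S i) (L * b) (i + 1)
  · refine ⟨charAt S i :: e, e.length, ?_, fun x => ?_, by simp, fun _ => by simp, ?_⟩
    · refine List.nodup_cons.2 ⟨fun hx => ?_, hnd⟩
      have := (he _).1 hx
      have := occ_succ_self (charAt S) i
      unfold freq at *
      omega
    · rw [lt_freq_succ_iff, ← he, List.mem_cons, or_comm]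
      simp [hc]
    · intro t x q g y p out
      refine ends_blockStep (T := 20 * (i % b) + 20 * (b + 1) * e.length + 20) hS hD hi hk
        (fun _ t x q y => ?_) fun hx => absurd hc hx
      simpa using hE t x q g y p (out ++ [charAt S i])
  · refine ⟨e, e.length, hnd, fun x => ?_, le_rfl, fun hx => absurd hx hc, ?_⟩
    · rw [lt_freq_succ_iff, ← he]
      simp [hc]
    · intro t x q g y p out
      exact ends_blockStep (T := 20 * (i % b) + 20 * (b + 1) * e.length + 20) hS hD hi hk
        (fun hx => absurd hx hc) fun _ t x q y => hE ..

/-- The output of the modes of a run of full blocks takes `O(b)` time per mode. -/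
theorem exists_ends_blocks (hS : ∀ i, S i < 2 ^ w) (hD : IsIndex w n (charAt S) b M D)
    (hn : 0 < n) (hL : L < M) (hk : k ≤ n) {R' : ℕ} (hR' : R' < M) (hRn : R' * b ≤ n)
    (hmax : ∀ x, ∀ a ≤ R' * b, freq (charAt S) x (L * b) a ≤ k + 1)
    (hX : ∀ i < R' * b, BlockGoal w S D work l r b M L R k i) :
    ∃ e : List ℕ, e.Nodup ∧ (∀ x, x ∈ e ↔ k < freq (charAt S) x (L * b) (R' * b)) ∧
      ∀ i t x q y out, Ends queryProgram w S D
        (st 71 (queryRegs l r b M L R (k + 1) i t x q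
          (maxFreq (charAt S) n (L * b) (R' * b)) y (k * 5) (R' * 5 + (L * (M * 5) + 3) + 1))
          work out) (20 * (b + 1) * e.length + 10) (out ++ e) := by
  have hle : maxFreq (charAt S) n (L * b) (R' * b) ≤ k + 1 := by
    obtain ⟨x, hx⟩ := exists_freq_eq_maxFreq (charAt S) hn (L * b) (R' * b)
    rw [← hx]
    exact hmax x _ le_rfl
  by_cases hc : maxFreq (charAt S) n (L * b) (R' * b) = k + 1
  · obtain ⟨h1, h2, h3⟩ := lastMode_spec (s := charAt S) hn (u := L * b) (v := R' * b) (by omega)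
    have hlast := hD.last L hL R' hR' hRn
    generalize lastMode (charAt S) n (L * b) (R' * b) = j at *
    obtain ⟨e, m, hnd, he, hm, hm', hE⟩ := (hX j h1).step hS hD (by omega) hk (hmax _ _ h1)
    refine ⟨e, hnd, fun x => ?_, ?_⟩
    · rw [he]
      constructor
      · intro hx
        have := freq_mono (charAt S) x (le_refl (L * b)) (show j + 1 ≤ R' * b from h1)
        omega
      · intro hx
        unfold freq at hx
        obtain ⟨j', h4, h5, h6, h7⟩ := exists_occ (s := charAt S) (x := x) (a := L * b)
          (b := R' * b) (k := occ (charAt S) x (R' * b) - 1) (by omega) (by omega)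
        -- `j'` is the last occurrence of `x` in the run, and behind `j` no character reaches the
        -- maximum; so cutting the run off after `j` loses no mode.
        have h8 : j' ≤ j := by
          by_contra hlt
          have h9 := h3 j' (by omega) h5
          have := occ_succ_self (charAt S) j'
          rw [h6] at h9 this
          unfold freq at h9
          omega
        have h10 := occ_mono (charAt S) x (show j' + 1 ≤ j + 1 by omega)
        have := occ_succ_self (charAt S) j'
        rw [h6] at this
        unfold freq
        omega
    · intro i t x q y out
      have hm'' := hm' (by omega)
      have hjb := Nat.mod_lt j hD.pos
      -- The mode output at `j` contributes `20 * (b + 1)`, which covers the walk of `j % b < b`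
      -- steps.
      have hT : 20 * (j % b) + 20 * (b + 1) * m + 32 + 2 ≤ 20 * (b + 1) * e.length + 10 := by
        rw [← hm'']
        nlinarith
      refine Ends.mono ?_ hT
      unfold queryRegs at *
      refine ends_jumpEq rfl (fun hc1 => ?_) fun hc1 => ?_
      · exact ends_readIndex rfl rfl hlast (hE ..)
      · simp only [List.getD_cons_succ, List.getD_cons_zero] at hc1
        omega
  · refine ⟨[], List.nodup_nil, fun x => ?_, fun i t x q y out => ?_⟩
    · have := freq_le_maxFreq hRn (charAt S) x (L * b)
      simp
      omega
    · refine (Ends.mono (T := 1 + 1) ?_ (by omega))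
      rw [List.append_nil]
      unfold queryRegs
      refine ends_jumpEq rfl (fun hc1 => ?_) fun hc1 => ends_halt rfl
      simp only [List.getD_cons_succ, List.getD_cons_zero] at hc1
      omega

/-- Strong induction on the position: at a block boundary the table leads to a position before `i`
or to a halt, elsewhere the program goes on at `i - 1`. -/
theorem blockGoal (hS : ∀ i, S i < 2 ^ w) (hD : IsIndex w n (charAt S) b M D)
    (hn : 0 < n) (hL : L < M) (hR : R < M) (hRn : R * b ≤ n) (hk : k ≤ n)
    (hmax : ∀ x, ∀ a ≤ R * b, freq (charAt S) x (L * b) a ≤ k + 1) (i : ℕ) (hi : i < R * b) :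
    BlockGoal w S D work l r b M L R k i := by
  induction i using Nat.strong_induction_on with
  | _ i ih =>
  have hb := hD.pos
  have hw := hD.word
  have hw' := hD.word'
  by_cases hc : i % b = 0
  · have hib : i / b * b = i := Nat.div_mul_cancel (Nat.dvd_of_mod_eq_zero hc)
    have hR' : i / b < M := by
      have : i / b < R := (Nat.div_lt_iff_lt_mul hb).2 hi
      omega
    obtain ⟨e, hnd, he, hE⟩ := exists_ends_blocks (work := work) (l := l) (r := r) (R := R) hS hD hn
      hL hk hR' (by omega) (fun x a ha => hmax x a (by omega)) fun j hj => ih j (by omega) (by omega)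
    rw [hib] at he
    refine ⟨e, hnd, he, fun t x q g y p out => ?_⟩
    have hfr := hD.freq L hL (i / b) hR' (by omega)
    have hm := Nat.mul_le_mul_right (M * 5) (show L + 1 ≤ M from hL)
    rw [hib] at hE hfr
    rw [Nat.succ_mul] at hm
    refine (Ends.mono (T := 20 * (b + 1) * e.length + 10 + 8) ?_ (by omega))
    unfold queryRegs at *
    refine ends_mod rfl rfl ?_ ?_
    · simp; omega
    simp only [List.getD_cons_succ, List.getD_cons_zero, List.set_cons_succ, List.set_cons_zero]
    refine ends_jumpEq rfl (fun _ => ?_) fun hne => absurd hc hne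
    refine ends_div rfl rfl ?_ ?_
    · simp; omega
    refine ends_mul rfl rfl ?_ ?_
    · simp; omega
    refine ends_add rfl rfl ?_ ?_
    · simp; omega
    refine ends_add rfl rfl ?_ ?_
    · simp; omega
    refine ends_readIndex rfl rfl hfr (ends_jump rfl ?_)
    exact hE ..
  · have hi0 : i ≠ 0 := by rintro rfl; simp at hc
    obtain ⟨j, rfl⟩ := Nat.exists_eq_succ_of_ne_zero hi0
    obtain ⟨e, m, hnd, he, hm, -, hE⟩ := (ih j (by omega) (by omega)).step hS hD (by omega) hk
      (hmax _ _ (by omega))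
    have hjb : (j + 1) % b = j % b + 1 := by
      have h1 := Nat.mod_lt j hb
      rw [Nat.succ_eq_add_one, ← Nat.mod_add_mod] at hc
      rw [← Nat.mod_add_mod]
      refine Nat.mod_eq_of_lt (lt_of_le_of_ne h1 fun h2 => hc ?_)
      rw [show j % b + 1 = b from h2, Nat.mod_self]
    refine ⟨e, hnd, he, fun t x q g y p out => ?_⟩
    have hT : 20 * (j % b) + 20 * (b + 1) * m + 32 + 4 ≤
        20 * ((j + 1) % b) + 20 * (b + 1) * e.length + 20 := by
      have := Nat.mul_le_mul_left (20 * (b + 1)) hm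
      omega
    refine Ends.mono ?_ hT
    unfold queryRegs at *
    refine ends_mod rfl rfl ?_ ?_
    · simp; omega
    simp only [List.getD_cons_succ, List.getD_cons_zero, List.set_cons_succ, List.set_cons_zero]
    refine ends_jumpEq rfl (fun h0 => absurd h0 hc) fun _ => ?_
    refine ends_sub rfl rfl ?_ ?_ (ends_jump rfl ?_)
    · simp
    · simp; omega
    exact hE ..

theorem queryConfig_eq (hl : l < 2 ^ w) (hr : r < 2 ^ w) :
    queryConfig w l r work =
      st 0 [l, r, 0, 0, 0, 0, 0, 0, 0, 0, 0, 0, 0, 0, 0, 0, 0, 0, 0] work [] := by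
  simp only [queryConfig, st, Config.mk.injEq, and_true, true_and, Nat.mod_eq_of_lt hl,
    Nat.mod_eq_of_lt hr]
  funext i
  rcases i with _ | _ | i
  · rfl
  · rfl
  · rw [if_neg (by omega), if_neg (by omega)]
    change 0 = (List.replicate 17 0).getD i 0
    rw [List.getD_eq_getElem?_getD, List.getElem?_replicate]
    split_ifs <;> rfl

theorem ends_setup (hD : IsIndex w n (charAt S) b M D) (hQ : IsQuery n b M l r L R)
    (hL : (l + b - 1) / b = L) (hR : (r + 1) / b = R)
    (hcont : Ends queryProgram w S D
      (st 20 (queryRegs l r b M L R (maxFreq (charAt S) n (L * b) (R * b)) l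
        (R * 5 + (L * (M * 5) + 3)) 0 0 (maxFreq (charAt S) n (L * b) (R * b)) 0 0
        (R * 5 + (L * (M * 5) + 3) + 1)) work []) T o) :
    Ends queryProgram w S D (queryConfig w l r work) (T + 20) o := by
  have hw := hD.word
  have hw' := hD.word'
  have hb := hD.pos
  have hbn := hD.le
  have hlr := hQ.le
  have hrn := hQ.lt
  have hLM := hQ.rowL
  have hRM := hQ.rowR
  have hql := hQ.left'
  have hqr := hQ.right
  have hm := Nat.mul_le_mul_right (M * 5) (show L + 1 ≤ M from hLM)
  have hfr := hD.freq L hLM R hRM (by omega)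
  have hF := maxFreq_le (charAt S) n (L * b) (R * b)
  rw [Nat.succ_mul] at hm
  rw [queryConfig_eq (by omega) (by omega)]
  unfold queryRegs at hcont
  refine ends_const rfl rfl (by omega) (ends_const rfl rfl (by omega) ?_)
  refine ends_readIndex rfl rfl hD.block (ends_readIndex rfl rfl hD.row ?_)
  refine ends_add rfl rfl ?_ (ends_sub rfl rfl ?_ ?_ (ends_div rfl rfl ?_ ?_))
  · simp; omega
  · simp; omega
  · simp; omega
  · simp; omega
  simp only [List.getD_cons_succ, List.getD_cons_zero, List.set_cons_succ, List.set_cons_zero, hL]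
  refine ends_mul rfl rfl ?_ (ends_const rfl rfl (by omega) (ends_add rfl rfl ?_
    (ends_mul rfl rfl ?_ (ends_add rfl rfl ?_ (ends_div rfl rfl ?_ ?_)))))
  · simp; omega
  · simp; omega
  · simp; omega
  · simp; omega
  · simp; omega
  simp only [List.getD_cons_succ, List.getD_cons_zero, List.set_cons_succ, List.set_cons_zero, hR]
  refine ends_mul rfl rfl ?_ (ends_add rfl rfl ?_ (ends_add rfl rfl ?_ (ends_readIndex rfl rfl hfr
    (ends_add rfl rfl ?_ (ends_mul rfl rfl ?_ (ends_add rfl rfl ?_ ?_))))))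
  · simp; omega
  · simp; omega
  · simp; omega
  · simp; omega
  · simp; omega
  · simp; omega
  simpa only [List.getD_cons_succ, List.getD_cons_zero, List.set_cons_succ, List.set_cons_zero,
    add_zero] using hcont

theorem exists_ends_query (hS : ∀ i, S i < 2 ^ w) (hD : IsIndex w n (charAt S) b M D)
    (hQ : IsQuery n b M l r L R) (hL : (l + b - 1) / b = L) (hR : (r + 1) / b = R) :
    ∃ out : List ℕ, out.Nodup ∧
      (∀ x, x ∈ out ↔ freq (charAt S) x l (r + 1) = maxFreq (charAt S) n l (r + 1)) ∧
      Ends queryProgram w S D (queryConfig w l r work) (300 * b * out.length) out := by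
  have hw := hD.word
  have hb := hD.pos
  have hlr := hQ.le
  have hrn := hQ.lt
  have hl := hQ.left
  have hl' := hQ.left'
  have hr := hQ.right
  have hr' := hQ.right'
  have ho := hQ.order
  have hn : 0 < n := by omega
  have hFn := maxFreq_le (charAt S) n l (r + 1)
  have hadd := maxFreq_le_add (s := charAt S) hQ.isPart
  have hpart : maxFreq (charAt S) n (L * b) (R * b) ≤ maxFreq (charAt S) n l (r + 1) := by
    obtain ⟨x, hx⟩ := exists_freq_eq_maxFreq (charAt S) hn (L * b) (R * b)
    rw [← hx]
    exact (freq_mono _ _ hl hr).trans (freq_le_maxFreq (show r + 1 ≤ n from hrn) _ _ _)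
  obtain ⟨k, hk⟩ : ∃ k, maxFreq (charAt S) n l (r + 1) = k + 1 := by
    refine Nat.exists_eq_succ_of_ne_zero ?_
    have h1 := freq_le_maxFreq (show r + 1 ≤ n from hrn) (charAt S) (charAt S l) l
    have h2 := occ_lt_occ (s := charAt S) (show l < r + 1 by omega)
    unfold freq at h1
    omega
  have hmax : ∀ x, ∀ a ≤ R * b, freq (charAt S) x (L * b) a ≤ k + 1 := by
    intro x a ha
    rw [← hk]
    exact (freq_mono _ _ hl (ha.trans hr)).trans (freq_le_maxFreq (show r + 1 ≤ n from hrn) _ _ _)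
  have hRn : R * b ≤ n := by omega
  obtain ⟨e, hnde, he, hE⟩ := exists_ends_blocks (work := work) (l := l) (r := r) (R := R) hS hD hn
    hQ.rowL (show k ≤ n by omega) hQ.rowR hRn hmax
    fun i hi => blockGoal hS hD hn hQ.rowL hQ.rowR hRn (by omega) hmax i hi
  obtain ⟨out, hndo, hout, hO⟩ := ends_reportLoop (D := D) (work := work) hS hD hQ hk (2 * b) l []
    le_rfl (by omega) (.inl hl) List.nodup_nil
    (fun x => by
      simp only [List.not_mem_nil, false_iff]
      rintro ⟨j, h1, h2, -⟩
      have := h2.1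
      omega)
    (by omega)
  have hmem : ∀ x, x ∈ out ++ e ↔ freq (charAt S) x l (r + 1) = k + 1 := by
    intro x
    rw [List.mem_append, hout, he, exists_isReported_iff hQ.isPart hk,
      lt_freq_part_iff hQ.isPart hk]
    -- A mode either occurs outside of the full blocks or it does not.
    rw [← and_or_left, and_iff_left (Classical.em _)]
  refine ⟨out ++ e, List.Nodup.append hndo hnde ?_, hk ▸ hmem, ?_⟩
  · intro x hx hx'
    rw [hout, exists_isReported_iff hQ.isPart hk] at hx
    rw [he, lt_freq_part_iff hQ.isPart hk] at hx'
    exact hx'.2 hx.2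
  have hlen : 1 ≤ (out ++ e).length := by
    obtain ⟨x, hx⟩ := exists_freq_eq_maxFreq (charAt S) hn l (r + 1)
    exact List.length_pos_of_mem ((hmem x).2 (hx.trans hk))
  -- The second loop visits at most `2 * b` positions; the first also raises `f` at most `2 * b`
  -- times. The terms without `e.length` are absorbed because the output is non-empty.
  have hT : 20 * (b + 1) * e.length + 10 + 23 * (2 * b) + 23 + 2 + 23 * (4 * b) + 23 + 20 ≤
      300 * b * (out ++ e).length := by
    have h1 : e.length ≤ (out ++ e).length := by simp
    generalize (out ++ e).length = N at *
    have h2 := Nat.mul_le_mul_left (20 * (b + 1)) h1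
    have h3 := Nat.mul_le_mul_right N hb
    have h4 := Nat.mul_le_mul_left b hlen
    nlinarith
  refine Ends.mono ?_ hT
  refine ends_setup hD hQ hL hR ?_
  refine ends_scanLoop hS hD hQ ?_ (4 * b) l _ _ _ _ _ le_rfl (by omega) (.inl hl) hpart ?_ le_rfl
    (by omega)
  · intro i t x q y
    rw [hk]
    unfold queryRegs at *
    refine ends_sub rfl rfl ?_ ?_ (ends_add rfl rfl ?_ ?_)
    · simp
    · simp; omega
    · simp; omega
    simp only [List.getD_cons_succ, List.getD_cons_zero, List.set_cons_succ, List.set_cons_zero,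
      add_zero, Nat.succ_mul, Nat.add_sub_cancel]
    have := hO (k + 1) (maxFreq (charAt S) n (L * b) (R * b)) (R * 5 + (L * (M * 5) + 3) + 1)
      (out ++ e) _ (fun i t x q y => hE i t x q y out) t x q y
    simpa only [Nat.succ_mul] using this
  · intro j hj hjl
    have := hj.1
    omega

end

/-! ### The index -/

/-- Entry `k` of table `j` of the index. -/
noncomputable def indexEntry (s : ℕ → ℕ) (n b M : ℕ) (j k : ℕ) : ℕ :=
  match j with
  | 0 => if k = 0 then b else M * 5
  | 1 => rank s n k * 5 + 2
  | 2 => posOfRank s n k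
  | 3 => maxFreq s n (k / M * b) (k % M * b) * 5
  | _ => lastMode s n (k / M * b) (k % M * b)

/-- The index: five interleaved tables with `N` entries each. -/
noncomputable def indexTables (w : ℕ) (s : ℕ → ℕ) (n b M N : ℕ) : List ℕ :=
  (List.range (5 * N)).map fun a => indexEntry s n b M (a % 5) (a / 5) % 2 ^ w

section
variable {w n b M N j k : ℕ}

theorem getD_indexTables (s : ℕ → ℕ) (hk : k < N) (hj : j < 5)
    (hv : indexEntry s n b M j k < 2 ^ w) :
    (indexTables w s n b M N).getD (k * 5 + j) 0 % 2 ^ w = indexEntry s n b M j k := by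
  have h : k * 5 + j < 5 * N := by omega
  have h1 : (k * 5 + j) % 5 = j := by omega
  have h2 : (k * 5 + j) / 5 = k := by omega
  simp [indexTables, List.getD_eq_getElem?_getD, List.getElem?_map, List.getElem?_range h, h1, h2,
    Nat.mod_eq_of_lt hv]

/-- The common table length has room for the shifted ranks below `3 * n`, the `M * M` runs and the
two parameters. -/
theorem isIndex_indexTables (s : ℕ → ℕ) (hb : 0 < b) (hbn : b ≤ n)
    (hw : 20 * n + 20 < 2 ^ w) (hw' : M * (M * 5) + M * 5 + 20 < 2 ^ w) :
    IsIndex w n s b M (indexTables w s n b M (3 * n + M * M + 2)) where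
  pos := hb
  le := hbn
  word := hw
  word' := hw'
  block := getD_indexTables (k := 0) (j := 0) s (by omega) (by omega) (by
    simp only [indexEntry, if_true]; omega)
  row := getD_indexTables (k := 1) (j := 0) s (by omega) (by omega) (by
    simp only [indexEntry, one_ne_zero, if_false]; omega)
  rank i hi := getD_indexTables (k := i) (j := 1) s (by omega) (by omega) (by
    have := rank_lt (s := s) hi
    simp only [indexEntry]; omega)
  posOfRank k hk := getD_indexTables (k := k) (j := 2) s (by omega) (by omega) (by
    have := posOfRank_le s n k
    simp only [indexEntry]; omega)
  freq L hL R hR hRn := by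
    have h0 : R * 5 + (L * (M * 5) + 3) = (L * M + R) * 5 + 3 := by ring
    have h1 : (L * M + R) / M = L := by
      rw [mul_comm, Nat.mul_add_div (by omega), Nat.div_eq_of_lt hR, add_zero]
    have h2 : (L * M + R) % M = R := by
      rw [mul_comm, Nat.mul_add_mod, Nat.mod_eq_of_lt hR]
    have h3 := Nat.mul_le_mul_right M (show L + 1 ≤ M from hL)
    rw [Nat.succ_mul] at h3
    have h4 := maxFreq_le s n (L * b) (R * b)
    have h5 : indexEntry s n b M 3 (L * M + R) = maxFreq s n (L * b) (R * b) * 5 := by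
      simp only [indexEntry, h1, h2]
    rw [h0, getD_indexTables s (by omega) (by omega) (by omega), h5]
  last L hL R hR hRn := by
    have h0 : R * 5 + (L * (M * 5) + 3) + 1 = (L * M + R) * 5 + 4 := by ring
    have h1 : (L * M + R) / M = L := by
      rw [mul_comm, Nat.mul_add_div (by omega), Nat.div_eq_of_lt hR, add_zero]
    have h2 : (L * M + R) % M = R := by
      rw [mul_comm, Nat.mul_add_mod, Nat.mod_eq_of_lt hR]
    have h3 := Nat.mul_le_mul_right M (show L + 1 ≤ M from hL)
    rw [Nat.succ_mul] at h3
    have h4 := lastMode_le s n (L * b) (R * b)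
    have h5 : indexEntry s n b M 4 (L * M + R) = lastMode s n (L * b) (R * b) := by
      simp only [indexEntry, h1, h2]
    rw [h0, getD_indexTables s (by omega) (by omega) (by omega), h5]

/-- The row length is `n / b + 2` because rounding `l / b` up can give `n / b + 1`. -/
theorem isQuery_div {l r : ℕ} (hb : 0 < b) (hl : l ≤ r) (hr : r < n) :
    IsQuery n b (n / b + 2) l r ((l + b - 1) / b) ((r + 1) / b) := by
  have h1 := Nat.div_mul_le_self (l + b - 1) b
  have h2 := Nat.lt_div_mul_add (a := l + b - 1) hb
  have h3 := Nat.div_mul_le_self (r + 1) b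
  have h4 := Nat.lt_div_mul_add (a := r + 1) hb
  have h5 : (l + b - 1) / b ≤ (n + b) / b := Nat.div_le_div_right (by omega)
  have h6 : (r + 1) / b ≤ n / b := Nat.div_le_div_right hr
  rw [Nat.add_div_right _ hb] at h5
  refine ⟨hl, hr, by omega, by omega, by omega, by omega, h3, h4, ?_⟩
  rcases le_or_gt ((l + b - 1) / b) ((r + 1) / b) with h | h
  · exact .inl (Nat.mul_le_mul_right b h)
  · have h7 := Nat.mul_le_mul_right b (show (r + 1) / b + 1 ≤ (l + b - 1) / b from h)
    rw [Nat.succ_mul] at h7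
    exact .inr (by omega)

theorem word_bounds (hn : 0 < n) (hw : 16 * n.size ≤ w) (hM : M ≤ n + 2) :
    20 * n + 20 < 2 ^ w ∧ M * (M * 5) + M * 5 + 20 < 2 ^ w := by
  have h1 : n + 1 ≤ 2 ^ n.size := Nat.lt_size_self n
  have h2 : (n + 1) ^ 16 ≤ 2 ^ w := by
    calc (n + 1) ^ 16 ≤ (2 ^ n.size) ^ 16 := Nat.pow_le_pow_left h1 _
      _ = 2 ^ (16 * n.size) := by rw [← pow_mul, mul_comm]
      _ ≤ 2 ^ w := Nat.pow_le_pow_right (by norm_num) hw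
  have h3 : 2 ^ 14 * (n + 1) ^ 2 ≤ (n + 1) ^ 16 := by
    rw [show (n + 1) ^ 16 = (n + 1) ^ 14 * (n + 1) ^ 2 by ring]
    exact Nat.mul_le_mul_right _ (Nat.pow_le_pow_left (by omega) _)
  have h4 : M * M ≤ (n + 2) * (n + 2) := Nat.mul_le_mul hM hM
  constructor <;> nlinarith

end

theorem size_le_two_mul_logb {n : ℕ} (hn : 2 ≤ n) : (n.size : ℝ) ≤ 2 * Real.logb 2 n := by
  have hs : n.size - 1 < n.size := by
    have := Nat.size_pos.2 (show 0 < n by omega)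
    omega
  have h1 : ((n.size - 1 : ℕ) : ℝ) ≤ Real.logb 2 n := by
    rw [Real.le_logb_iff_rpow_le (by norm_num) (by positivity), Real.rpow_natCast]
    exact_mod_cast Nat.lt_size.1 hs
  have h2 : 1 ≤ Real.logb 2 n := by
    rw [Real.le_logb_iff_rpow_le (by norm_num) (by positivity), Real.rpow_one]
    exact_mod_cast hn
  have h3 : (n.size : ℝ) ≤ ((n.size - 1 : ℕ) : ℝ) + 1 := by
    exact_mod_cast (show n.size ≤ n.size - 1 + 1 by omega)
  linarith

/-- With `x = n ^ (1 - ε) ≥ 1`, one has `n ≤ x²` (here `ε ≤ 1/2` enters) and `n / b ≤ x`, so the sum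
is at most `3x² + (3x)² + 2x²`. -/
theorem indexSize_le {n : ℕ} (hn : 0 < n) {ε : ℝ} (h1 : ε ≤ 1 / 2) :
    ((3 * n + (n / ⌈(n : ℝ) ^ ε⌉₊ + 2) * (n / ⌈(n : ℝ) ^ ε⌉₊ + 2) + 2 : ℕ) : ℝ) ≤
      14 * (n : ℝ) ^ (2 - 2 * ε) := by
  have hn1 : (1 : ℝ) ≤ n := by exact_mod_cast hn
  have hn0 : (0 : ℝ) < n := by linarith
  have hx : (n : ℝ) ^ (2 - 2 * ε) = (n : ℝ) ^ (1 - ε) * (n : ℝ) ^ (1 - ε) := by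
    rw [← Real.rpow_add hn0]
    ring_nf
  have hnx : (n : ℝ) ≤ (n : ℝ) ^ (2 - 2 * ε) := by
    calc (n : ℝ) = (n : ℝ) ^ (1 : ℝ) := (Real.rpow_one _).symm
      _ ≤ _ := Real.rpow_le_rpow_of_exponent_le hn1 (by linarith)
  have hx1 : 1 ≤ (n : ℝ) ^ (1 - ε) := Real.one_le_rpow hn1 (by linarith)
  have hd : ((n / ⌈(n : ℝ) ^ ε⌉₊ : ℕ) : ℝ) ≤ (n : ℝ) ^ (1 - ε) := by
    refine Nat.cast_div_le.trans ?_
    rw [Real.rpow_sub hn0, Real.rpow_one]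
    exact div_le_div_of_nonneg_left hn0.le (Real.rpow_pos_of_pos hn0 _) (Nat.le_ceil _)
  have hd0 : (0 : ℝ) ≤ ((n / ⌈(n : ℝ) ^ ε⌉₊ : ℕ) : ℝ) := Nat.cast_nonneg _
  rw [hx] at hnx ⊢
  push_cast [-Nat.cast_div_charZero] at hd hd0 ⊢
  generalize ((n / ⌈(n : ℝ) ^ ε⌉₊ : ℕ) : ℝ) = d at *
  generalize (n : ℝ) ^ (1 - ε) = x at *
  nlinarith

end RangeMode

/-! ### Choice of the block size and the constants -/

theorem mainTheorem8 :
    ∃ (P : RangeMode.Program) (c₀ : ℕ), ∀ c : ℕ, ∃ K : ℝ,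
      ∀ ε : ℝ, 0 ≤ ε → ε ≤ 1 / 2 →
      ∀ n w : ℕ, c₀ * n.size ≤ w → w ≤ c * n.size →
      ∀ S : Fin n → ℕ, (∀ i, S i < 2 ^ w) →
      ∃ (D : List ℕ) (m : ℕ),
        (∀ d ∈ D, d < 2 ^ w) ∧
        (2 ≤ n → (w : ℝ) * (D.length + m) ≤ K * ((n : ℝ) ^ (2 - 2 * ε) * Real.logb 2 n)) ∧
        ∀ l r : Fin n, l ≤ r →
          RangeMode.SolvesQuery P w S D m (K * (n : ℝ) ^ ε) l r := by
  -- Space: `5` tables, `14` from `indexSize_le` and `2` from `size_le_two_mul_logb` give `140`.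
  -- Time: `300 * b` with `b ≤ 2 * n ^ ε` gives `600`. The factor `16` keeps all addresses below `2
  -- ^ w`.
  refine ⟨RangeMode.queryProgram, 16, fun c => ⟨140 * c + 600, fun ε h0 h1 n w hw hwc S hS => ?_⟩⟩
  rcases Nat.eq_zero_or_pos n with rfl | hn
  · exact ⟨[], 0, by simp, by simp, fun l => l.elim0⟩
  have hn1 : (1 : ℝ) ≤ n := by exact_mod_cast hn
  have hε1 : 1 ≤ (n : ℝ) ^ ε := Real.one_le_rpow hn1 h0
  have hbn : ⌈(n : ℝ) ^ ε⌉₊ ≤ n := by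
    refine Nat.ceil_le.2 ?_
    calc (n : ℝ) ^ ε ≤ (n : ℝ) ^ (1 : ℝ) := Real.rpow_le_rpow_of_exponent_le hn1 (by linarith)
      _ = n := Real.rpow_one _
  have hb : 0 < ⌈(n : ℝ) ^ ε⌉₊ := Nat.ceil_pos.2 (by linarith)
  have hb2 : (⌈(n : ℝ) ^ ε⌉₊ : ℝ) ≤ 2 * (n : ℝ) ^ ε := by
    have := Nat.ceil_lt_add_one (show 0 ≤ (n : ℝ) ^ ε by linarith)
    linarith
  have hN := RangeMode.indexSize_le hn h1
  generalize ⌈(n : ℝ) ^ ε⌉₊ = b at *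
  have hM : n / b + 2 ≤ n + 2 := Nat.add_le_add_right (Nat.div_le_self _ _) _
  obtain ⟨hw1, hw2⟩ := RangeMode.word_bounds hn hw hM
  have hD := RangeMode.isIndex_indexTables (RangeMode.charAt S) hb hbn hw1 hw2
  refine ⟨RangeMode.indexTables w (RangeMode.charAt S) n b (n / b + 2)
    (3 * n + (n / b + 2) * (n / b + 2) + 2), 0, ?_, fun hn2 => ?_, fun l r hlr work _ _ => ?_⟩
  · intro d hd
    obtain ⟨a, -, rfl⟩ := List.mem_map.1 hd
    exact Nat.mod_lt _ (by positivity)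
  · have hlog := RangeMode.size_le_two_mul_logb hn2
    have hwr : (w : ℝ) ≤ c * (2 * Real.logb 2 n) := by
      calc (w : ℝ) ≤ c * n.size := by exact_mod_cast hwc
        _ ≤ _ := by gcongr
    have hlog0 : 0 ≤ Real.logb 2 n := by
      have : (0 : ℝ) ≤ n.size := Nat.cast_nonneg _
      linarith
    have hx0 : 0 ≤ (n : ℝ) ^ (2 - 2 * ε) := by positivity
    rw [RangeMode.indexTables, List.length_map, List.length_range, Nat.cast_mul, Nat.cast_ofNat,
      Nat.cast_zero, add_zero]
    calc (w : ℝ) * (5 * _) ≤ c * (2 * Real.logb 2 n) * (5 * (14 * (n : ℝ) ^ (2 - 2 * ε))) := by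
          gcongr
      _ = 140 * c * ((n : ℝ) ^ (2 - 2 * ε) * Real.logb 2 n) := by ring
      _ ≤ _ := by
          gcongr
          linarith
  · obtain ⟨out, hnd, hout, t, ht, hE⟩ := RangeMode.exists_ends_query (work := work) hS hD
      (RangeMode.isQuery_div hb (show (l : ℕ) ≤ r from hlr) r.2) rfl rfl
    refine ⟨t, out, hE, hnd, fun x => ?_, ?_⟩
    · rw [hout, RangeMode.isMode_rangeMultiset_iff S hlr]
    · calc (t : ℝ) ≤ ((300 * b * out.length : ℕ) : ℝ) := by exact_mod_cast ht
        _ = 300 * b * out.length := by push_cast; ring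
        _ ≤ 300 * (2 * (n : ℝ) ^ ε) * out.length := by gcongr
        _ ≤ (140 * c + 600) * (n : ℝ) ^ ε * out.length := by
          have : (0 : ℝ) ≤ c := Nat.cast_nonneg c
          gcongr ?_ * _
          nlinarith
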